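/- Let $Z$ and $G$ be discrete, with $G$ a group, let $\alpha$ be an action of $G$ on $C_0(Z)$ by $*$-automorphisms, and let $C_0(Z)$ act faithfully on a Hilbert space $H$. The reduced crossed product $C_0(Z)\rtimes_{\alpha,r}G$ is the norm closure in $B(\ell^2(G,H))$ of the operators $\pi\rtimes\lambda(f)=\sum_{s}\pi(f(s))\lambda_s$, $f\in\ell^1(G,C_0(Z))$, where $(\pi(a)\xi)(s)=\alpha_s^{-1}(a)\xi(s)$ and $(\lambda_r\xi)(s)=\xi(r^{-1}s)$. A central Herz–Schur $(C_0(Z),G,\alpha)$-multiplier is a bounded function $F:G\to CB(C_0(Z))$, each $F(r)$ being the multiplication by an element of the centre of the multiplier algebra of $C_0(Z)$ (so $F(r)(a)(z)=\varphi(z,r)a(z)$ for a function $\varphi$ on $Z\times G$), such that $\pi\rtimes\lambda(f)\mapsto\pi\rtimes\lambda(F\cdot f)$, with $(F\cdot f)(r)=F(r)(f(r))$, extends to a completely bounded map $S_F$ on $C_0(Z)\rtimes_{\alpha,r}G$. The space $\mathfrak S_{\rm cent}(C_0(Z),G,\alpha)$ of these multipliers is normed by $\|F\|_{\rm m}=\|S_F\|_{\rm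 cb}$. Finitely supported functions $\psi$ on $Z\times G$ act on it by $\langle\psi,\varphi\rangle=\sum_{z,s}\psi(z,s)\varphi(z,s)$; let $Q_{\rm cent}(Z,G,\alpha)$ be the completion (that is, the norm closure) of $C_c(Z\times G)$ in the dual space $\mathfrak S_{\rm cent}(C_0(Z),G,\alpha)^*$. For $a\in (C_0(Z)\rtimes_{\alpha,r}G)\otimes K(\ell^2)$ (minimal tensor product) and a normal functional $f$ on the von Neumann tensor product $(C_0(Z)\rtimes_{\alpha,r}G)''\,\overline\otimes\,B(\ell^2)$ put $\omega_{a,f}(F)=f\big((S_F\otimes{\rm id})(a)\big)$. Then $Q_{\rm cent}(Z,G,\alpha)^*=\mathfrak S_{\rm cent}(C_0(Z),G,\alpha)$: the canonical map sending $F$ to the functional $q\mapsto q(F)$ on $Q_{\rm cent}(Z,G,\alpha)$ is an isometric linear isomorphism of $\mathfrak S_{\rm cent}(C_0(Z),G,\alpha)$ onto the Banach dual of $Q_{\rm cent}(Z,G,\alpha)$. Moreover, as subsets of $\mathfrak S_{\rm cent}(C_0(Z),G,\alpha)^*$, $$Q_{\rm cent}(Z,G,\alpha)=\Big\{\omega_{a,f}: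 a\in (C_0(Z)\rtimes_{\alpha,r}G)\otimes K(\ell^2),\ f\in \big((C_0(Z)\rtimes_{\alpha,r}G)''\,\overline\otimes\,B(\ell^2)\big)_*\Big\}.$$ -/

import Mathlib

open scoped TensorProduct ZeroAtInfty InnerProductSpace MultiplierAlgebra Topology

noncomputable section

namespace HerzSchur

/-! ### Hilbert spaces of square-summable families -/

/-- The Hilbert space `ℓ²(I, K) = ℓ²(I) ⊗ K` of square-summable families in `K` indexed by `I`. -/
def L2 (I : Type*) (K : Type*) [NormedAddCommGroup K] : Type _ := lp (fun _ : I => K) 2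

namespace L2

variable {I : Type*} {K : Type*} [NormedAddCommGroup K] [InnerProductSpace ℂ K]

instance : NormedAddCommGroup (L2 I K) :=
  inferInstanceAs (NormedAddCommGroup (lp (fun _ : I => K) 2))

instance : InnerProductSpace ℂ (L2 I K) :=
  inferInstanceAs (InnerProductSpace ℂ (lp (fun _ : I => K) 2))

instance [CompleteSpace K] : CompleteSpace (L2 I K) :=
  inferInstanceAs (CompleteSpace (lp (fun _ : I => K) 2))

/-- The `i`-th coordinate. -/
def coord (i : I) : L2 I K →L[ℂ] K := lp.evalCLM ℂ (fun _ : I => K) 2 i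

/-- The family with the entry `k` at `i` and zeros elsewhere. -/
def single (i : I) : K →L[ℂ] L2 I K :=
  letI := Classical.decEq I
  lp.singleContinuousLinearMap ℂ (fun _ : I => K) 2 i

/-- A square-summable family as an element of `ℓ²(I, K)`. -/
def mk (f : I → K) (hf : Memℓp f 2) : L2 I K := ⟨f, hf⟩

@[simp] lemma coord_mk (f : I → K) (hf : Memℓp f 2) (i : I) : coord i (mk f hf) = f i := rfl

lemma memlp (ξ : L2 I K) : Memℓp (fun i => coord i ξ) 2 := lp.memℓp ξ

@[ext] lemma ext {ξ η : L2 I K} (h : ∀ i, coord i ξ = coord i η) : ξ = η := lp.ext (funext h)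

lemma coord_single [DecidableEq I] (i i' : I) (k : K) :
    coord i' (single i k) = if i' = i then k else 0 := by
  have h : coord i' (single i k) = @Pi.single I (fun _ => K) _ (Classical.decEq I) i k i' :=
    congrFun (@lp.coeFn_single I (fun _ => K) _ (Classical.decEq I) 2 i k) i'
  rw [h]
  rcases eq_or_ne i' i with rfl | hi
  · simp
  · simp [hi]

lemma hasSum_norm_sq (ξ : L2 I K) : HasSum (fun i => ‖coord i ξ‖ ^ 2) (‖ξ‖ ^ 2) := by
  have := lp.hasSum_norm (p := 2) (by simp) (show lp (fun _ : I => K) 2 from ξ)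
  simpa using! this

lemma norm_coord_le (i : I) (ξ : L2 I K) : ‖coord i ξ‖ ≤ ‖ξ‖ :=
  lp.norm_apply_le_norm (E := fun _ : I => K) (by simp) ξ i

lemma norm_single (i : I) (k : K) : ‖single i k‖ = ‖k‖ :=
  @lp.norm_single I (fun _ => K) 2 _ (Classical.decEq I) (by simp) i k

lemma hasSum_single (ξ : L2 I K) : HasSum (fun i => single i (coord i ξ)) ξ :=
  @lp.hasSum_single I (fun _ => K) 2 _ (Classical.decEq I) _ (by simp) ξ

lemma hasSum_inner (ξ η : L2 I K) : HasSum (fun i => ⟪coord i ξ, coord i η⟫_ℂ) ⟪ξ, η⟫_ℂ :=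
  lp.hasSum_inner (𝕜 := ℂ) (G := fun _ : I => K) ξ η

lemma memlp_iff {I K : Type*} [NormedAddCommGroup K] {f : I → K} : Memℓp f 2 ↔ Summable fun i => ‖f i‖ ^ 2 := by
  rw [memℓp_gen_iff (by simp)]
  simp

lemma norm_le_of_coord_le {J L : Type*} [NormedAddCommGroup L] [InnerProductSpace ℂ L]
    {ξ : L2 I K} {η : L2 J L} (e : I ≃ J) {C : ℝ} (hC : 0 ≤ C)
    (h : ∀ i, ‖coord i ξ‖ ≤ C * ‖coord (e i) η‖) : ‖ξ‖ ≤ C * ‖η‖ := by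
  refine le_of_sq_le_sq ?_ (by positivity)
  rw [mul_pow]
  refine hasSum_le (fun i => ?_) ξ.hasSum_norm_sq
    ((e.hasSum_iff.2 η.hasSum_norm_sq).mul_left (C ^ 2))
  rw [Function.comp_apply, ← mul_pow]
  exact pow_le_pow_left₀ (norm_nonneg _) (h i) 2

/-- The diagonal operator `(T ξ)(i) = T_i (ξ i)` of a bounded family of operators. -/
def diagOp (T : I → K →L[ℂ] K) (C : ℝ) (hT : ∀ i, ‖T i‖ ≤ C) : L2 I K →L[ℂ] L2 I K :=
  LinearMap.mkContinuous
    { toFun := fun ξ => mk (fun i => T i (coord i ξ)) <| by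
        refine memlp_iff.2 (Summable.of_nonneg_of_le (fun i => by positivity) (fun i => ?_)
          (ξ.hasSum_norm_sq.summable.mul_left (C ^ 2)))
        rw [← mul_pow]
        exact pow_le_pow_left₀ (norm_nonneg _) ((T i).le_of_opNorm_le (hT i) _) 2
      map_add' := fun ξ η => by ext i; simp
      map_smul' := fun c ξ => by ext i; simp }
    (max C 0) fun ξ => norm_le_of_coord_le (Equiv.refl I) (le_max_right _ _) fun i =>
      ((T i).le_of_opNorm_le (hT i) _).trans
        (mul_le_mul_of_nonneg_right (le_max_left _ _) (norm_nonneg _))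

@[simp] lemma coord_diagOp (T : I → K →L[ℂ] K) (C : ℝ) (hT : ∀ i, ‖T i‖ ≤ C) (ξ : L2 I K) (i : I) :
    coord i (diagOp T C hT ξ) = T i (coord i ξ) := rfl

/-- The permutation operator `(U ξ)(i) = ξ (e i)`. -/
def permOp (e : I ≃ I) : L2 I K →L[ℂ] L2 I K :=
  LinearMap.mkContinuous
    { toFun := fun ξ => mk (fun i => coord (e i) ξ) <|
        memlp_iff.2 ((e.summable_iff (f := fun i => ‖coord i ξ‖ ^ 2)).2 ξ.hasSum_norm_sq.summable)
      map_add' := fun ξ η => by ext i; simp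
      map_smul' := fun c ξ => by ext i; simp }
    1 fun ξ => norm_le_of_coord_le e zero_le_one fun i => by simp

@[simp] lemma coord_permOp (e : I ≃ I) (ξ : L2 I K) (i : I) :
    coord i (permOp e ξ) = coord (e i) ξ := rfl

end L2

/-! ### Completely bounded maps between concretely represented spaces of operators -/

section CompletelyBounded

variable {K : Type*} [NormedAddCommGroup K] [InnerProductSpace ℂ K]

/-- The operator on the Hilbert space `Kⁿ` with operator matrix `x ∈ M_n(B(K))`. -/
def blockOp {n : ℕ} (x : Matrix (Fin n) (Fin n) (K →L[ℂ] K)) : L2 (Fin n) K →L[ℂ] L2 (Fin n) K :=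
  ∑ i, ∑ j, L2.single i ∘L x i j ∘L L2.coord j

lemma blockOp_apply {n : ℕ} (x : Matrix (Fin n) (Fin n) (K →L[ℂ] K)) (ξ : L2 (Fin n) K)
    (i : Fin n) : L2.coord i (blockOp x ξ) = ∑ j, x i j (L2.coord j ξ) := by
  simp only [blockOp, sum_apply, map_sum, ContinuousLinearMap.comp_apply, L2.coord_single]
  rw [Finset.sum_comm]
  simp

lemma blockOp_add {n : ℕ} (x y : Matrix (Fin n) (Fin n) (K →L[ℂ] K)) :
    blockOp (x + y) = blockOp x + blockOp y := by
  ext ξ i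
  simp [blockOp_apply, Finset.sum_add_distrib]

lemma blockOp_smul {n : ℕ} (c : ℂ) (x : Matrix (Fin n) (Fin n) (K →L[ℂ] K)) :
    blockOp (c • x) = c • blockOp x := by
  ext ξ i
  simp [blockOp_apply, Finset.smul_sum]

variable {V : Type*} [AddCommGroup V] [Module ℂ V]

/-- For a space `V` of operators on `K`, embedded by `j : V → B(K)`: the linear map `Φ : V → V`
satisfies `‖Φ_n‖ ≤ C` for all its amplifications `Φ_n : M_n(V) → M_n(V)`, `n ∈ ℕ`, where
`M_n(V) ⊆ M_n(B(K)) = B(Kⁿ)` carries the operator norm. -/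
def CBBound (j : V →ₗ[ℂ] (K →L[ℂ] K)) (Φ : V →ₗ[ℂ] V) (C : ℝ) : Prop :=
  0 ≤ C ∧ ∀ (n : ℕ) (x : Matrix (Fin n) (Fin n) V),
    ‖blockOp (x.map fun v => j (Φ v))‖ ≤ C * ‖blockOp (x.map fun v => j v)‖

/-- Complete boundedness. -/
def IsCB (j : V →ₗ[ℂ] (K →L[ℂ] K)) (Φ : V →ₗ[ℂ] V) : Prop := ∃ C, CBBound j Φ C

/-- The completely bounded norm (meaningful for completely bounded maps only). -/
def cbNorm (j : V →ₗ[ℂ] (K →L[ℂ] K)) (Φ : V →ₗ[ℂ] V) : ℝ := sInf {C | CBBound j Φ C}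

variable {j : V →ₗ[ℂ] (K →L[ℂ] K)} {Φ Ψ : V →ₗ[ℂ] V} {C D : ℝ}

lemma CBBound.add (h : CBBound j Φ C) (h' : CBBound j Ψ D) : CBBound j (Φ + Ψ) (C + D) := by
  refine ⟨add_nonneg h.1 h'.1, fun n x => ?_⟩
  have : (x.map fun v => j ((Φ + Ψ) v)) = (x.map fun v => j (Φ v)) + x.map fun v => j (Ψ v) := by
    ext; simp
  rw [this, blockOp_add, add_mul]
  exact (norm_add_le _ _).trans (add_le_add (h.2 n x) (h'.2 n x))

lemma CBBound.smul (c : ℂ) (h : CBBound j Φ C) : CBBound j (c • Φ) (‖c‖ * C) := by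
  refine ⟨mul_nonneg (norm_nonneg _) h.1, fun n x => ?_⟩
  have : (x.map fun v => j ((c • Φ) v)) = c • (x.map fun v => j (Φ v)) := by
    ext; simp
  rw [this, blockOp_smul, norm_smul, mul_assoc]
  exact mul_le_mul_of_nonneg_left (h.2 n x) (norm_nonneg _)

lemma CBBound.zero : CBBound j (0 : V →ₗ[ℂ] V) 0 := by
  refine ⟨le_rfl, fun n x => ?_⟩
  have : (x.map fun v => j ((0 : V →ₗ[ℂ] V) v)) = (0 : ℂ) • (x.map fun v => j v) := by
    ext; simp
  rw [this, blockOp_smul]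
  simp

lemma cbNorm_nonneg : 0 ≤ cbNorm j Φ := Real.sInf_nonneg fun _ h => h.1

lemma CBBound.cbNorm_le (h : CBBound j Φ C) : cbNorm j Φ ≤ C :=
  csInf_le ⟨0, fun _ h => h.1⟩ h

/-- The infimum defining the completely bounded norm is attained. -/
lemma IsCB.bound (h : IsCB j Φ) : CBBound j Φ (cbNorm j Φ) := by
  refine ⟨cbNorm_nonneg, fun n x => ?_⟩
  rcases (norm_nonneg (blockOp (x.map fun v => j v))).eq_or_lt with h0 | h0
  · obtain ⟨C, hC⟩ := h
    have := hC.2 n x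
    rw [← h0] at this ⊢
    simpa using this
  · rw [← div_le_iff₀ h0]
    exact le_csInf h fun C hC => (div_le_iff₀ h0).2 (hC.2 n x)

lemma IsCB.cbNorm_add_le (h : IsCB j Φ) (h' : IsCB j Ψ) :
    cbNorm j (Φ + Ψ) ≤ cbNorm j Φ + cbNorm j Ψ := (h.bound.add h'.bound).cbNorm_le

lemma IsCB.cbNorm_smul (c : ℂ) (h : IsCB j Φ) : cbNorm j (c • Φ) = ‖c‖ * cbNorm j Φ := by
  refine le_antisymm (h.bound.smul c).cbNorm_le ?_
  rcases eq_or_ne c 0 with rfl | hc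
  · simpa using cbNorm_nonneg
  · have h1 : IsCB j (c • Φ) := ⟨_, h.bound.smul c⟩
    have h2 := (h1.bound.smul c⁻¹).cbNorm_le
    rw [smul_smul, inv_mul_cancel₀ hc, one_smul, norm_inv] at h2
    rwa [← le_inv_mul_iff₀ (norm_pos_iff.2 hc)]

lemma norm_blockOp_one (T : K →L[ℂ] K) :
    ‖blockOp (Matrix.of fun _ _ : Fin 1 => T)‖ = ‖T‖ := by
  have hn : ∀ ξ : L2 (Fin 1) K, ‖ξ‖ = ‖L2.coord 0 ξ‖ := fun ξ => by
    have := ξ.hasSum_norm_sq.unique (hasSum_fintype _)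
    simpa using this
  apply le_antisymm
  · refine ContinuousLinearMap.opNorm_le_bound _ (norm_nonneg _) fun ξ => ?_
    rw [hn, hn, blockOp_apply]
    simpa using T.le_opNorm (L2.coord 0 ξ)
  · refine ContinuousLinearMap.opNorm_le_bound _ (norm_nonneg _) fun k => ?_
    have := (blockOp (Matrix.of fun _ _ : Fin 1 => T)).le_opNorm (L2.single 0 k)
    rw [hn, hn, blockOp_apply] at this
    simpa [L2.coord_single] using this

/-- Completely bounded maps are bounded. -/
lemma CBBound.norm_le (h : CBBound j Φ C) (v : V) : ‖j (Φ v)‖ ≤ C * ‖j v‖ := by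
  have := h.2 1 (Matrix.of fun _ _ => v)
  simpa [Matrix.map, norm_blockOp_one] using this

end CompletelyBounded

/-! ### Tensor products with operators on `ℓ²` -/

section Tensor

/-- The Hilbert space `ℓ²(ℕ)`. -/
abbrev SeqL2 : Type := L2 ℕ ℂ

/-- The Hilbert space tensor product `K ⊗ ℓ²`. -/
def TensorL2 (K : Type*) [NormedAddCommGroup K] [InnerProductSpace ℂ K] : Type _ :=
  UniformSpace.Completion (K ⊗[ℂ] SeqL2)

variable {K : Type*} [NormedAddCommGroup K] [InnerProductSpace ℂ K]

instance : NormedAddCommGroup (TensorL2 K) :=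
  inferInstanceAs (NormedAddCommGroup (UniformSpace.Completion (K ⊗[ℂ] SeqL2)))

instance : InnerProductSpace ℂ (TensorL2 K) :=
  inferInstanceAs (InnerProductSpace ℂ (UniformSpace.Completion (K ⊗[ℂ] SeqL2)))

instance : CompleteSpace (TensorL2 K) :=
  inferInstanceAs (CompleteSpace (UniformSpace.Completion (K ⊗[ℂ] SeqL2)))

/-- The inclusion of the algebraic tensor product in the Hilbert space tensor product. -/
def toTensorL2 : (K ⊗[ℂ] SeqL2) →L[ℂ] TensorL2 K := UniformSpace.Completion.toComplL

lemma denseRange_toTensorL2 : DenseRange (toTensorL2 (K := K)) :=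
  UniformSpace.Completion.denseRange_coe

lemma inner_toTensorL2 (u v : K ⊗[ℂ] SeqL2) : ⟪toTensorL2 u, toTensorL2 v⟫_ℂ = ⟪u, v⟫_ℂ :=
  UniformSpace.Completion.inner_coe u v

/-- The elementary tensor `x ⊗ y ∈ K ⊗ ℓ²`, as a continuous map of `y`. -/
def tmulL2 (x : K) : SeqL2 →L[ℂ] TensorL2 K := toTensorL2 ∘L TensorProduct.mkL ℂ K SeqL2 x

lemma tmulL2_apply (x : K) (y : SeqL2) : tmulL2 x y = toTensorL2 (x ⊗ₜ[ℂ] y) := rfl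

lemma tmulL2_add (x x' : K) (y : SeqL2) : tmulL2 (x + x') y = tmulL2 x y + tmulL2 x' y := by
  simp [tmulL2_apply, TensorProduct.add_tmul]

lemma tmulL2_smul (c : ℂ) (x : K) (y : SeqL2) : tmulL2 (c • x) y = c • tmulL2 x y := by
  rw [tmulL2_apply, ← TensorProduct.smul_tmul', map_smul, tmulL2_apply]

lemma inner_tmulL2 (x x' : K) (y y' : SeqL2) :
    ⟪tmulL2 x y, tmulL2 x' y'⟫_ℂ = ⟪x, x'⟫_ℂ * ⟪y, y'⟫_ℂ := by
  simp [tmulL2_apply, inner_toTensorL2]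

/-- A closed subspace of `K ⊗ ℓ²` containing all elementary tensors is everything. -/
lemma mem_of_tmulL2_mem (S : Submodule ℂ (TensorL2 K)) (hS : IsClosed (S : Set (TensorL2 K)))
    (h : ∀ x y, tmulL2 x y ∈ S) (v : TensorL2 K) : v ∈ S := by
  refine denseRange_toTensorL2.induction_on v hS fun t => ?_
  induction t with
  | zero => simp
  | tmul x y => exact h x y
  | add t t' ht ht' => rw [map_add]; exact S.add_mem ht ht'

lemma tensorOp_ext {S T : TensorL2 K →L[ℂ] TensorL2 K}
    (h : ∀ (x : K) (y : SeqL2), S (tmulL2 x y) = T (tmulL2 x y)) : S = T := by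
  ext v
  exact mem_of_tmulL2_mem (LinearMap.eqLocus S.toLinearMap T.toLinearMap)
    (isClosed_eq S.continuous T.continuous) h v

/-- The operator `T ⊗ b` on `K ⊗ ℓ²`. -/
def tensorOp (T : K →L[ℂ] K) (b : SeqL2 →L[ℂ] SeqL2) : TensorL2 K →L[ℂ] TensorL2 K :=
  (TensorProduct.mapL T b).completion

@[simp] lemma tensorOp_tmulL2 (T : K →L[ℂ] K) (b : SeqL2 →L[ℂ] SeqL2) (x : K) (y : SeqL2) :
    tensorOp T b (tmulL2 x y) = tmulL2 (T x) (b y) :=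
  (TensorProduct.mapL T b).completion_apply_coe (x ⊗ₜ[ℂ] y)

variable (K) in
/-- `(T, b) ↦ T ⊗ b` as a bilinear map. -/
def tensorOpₗ : (K →L[ℂ] K) →ₗ[ℂ] (SeqL2 →L[ℂ] SeqL2) →ₗ[ℂ] (TensorL2 K →L[ℂ] TensorL2 K) :=
  LinearMap.mk₂ ℂ tensorOp
    (fun T S b => tensorOp_ext fun x y => by simp [tmulL2_add])
    (fun c T b => tensorOp_ext fun x y => by simp [tmulL2_smul])
    (fun T b b' => tensorOp_ext fun x y => by simp)
    (fun c T b => tensorOp_ext fun x y => by simp)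

/-- The algebra `K(ℓ²)` of compact operators on `ℓ²`. -/
abbrev CompactL2 : Submodule ℂ (SeqL2 →L[ℂ] SeqL2) := compactOperator (RingHom.id ℂ) SeqL2 SeqL2

/-- The algebraic tensor product `E ⊙ K(ℓ²)`. -/
def AlgTensor (E : Submodule ℂ (K →L[ℂ] K)) : Type _ := E ⊗[ℂ] CompactL2

namespace AlgTensor

variable {E : Submodule ℂ (K →L[ℂ] K)}

instance : AddCommGroup (AlgTensor E) := inferInstanceAs (AddCommGroup (E ⊗[ℂ] CompactL2))

instance : Module ℂ (AlgTensor E) := inferInstanceAs (Module ℂ (E ⊗[ℂ] CompactL2))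

/-- Elementary tensors. -/
def tmul (T : E) (b : CompactL2) : AlgTensor E := (T ⊗ₜ[ℂ] b : E ⊗[ℂ] CompactL2)

/-- The linear map on `E ⊙ K(ℓ²)` given by a bilinear map. -/
def lift {X : Type*} [AddCommGroup X] [Module ℂ X] (β : E →ₗ[ℂ] CompactL2 →ₗ[ℂ] X) :
    AlgTensor E →ₗ[ℂ] X := TensorProduct.lift β

lemma lift_tmul {X : Type*} [AddCommGroup X] [Module ℂ X] (β : E →ₗ[ℂ] CompactL2 →ₗ[ℂ] X)
    (T : E) (b : CompactL2) : lift β (tmul T b) = β T b := rfl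

/-- The linear map `T ⊗ b ↦ Φ(T) ⊗ b`. -/
def map (Φ : E →ₗ[ℂ] E) : AlgTensor E →ₗ[ℂ] AlgTensor E :=
  TensorProduct.map Φ (LinearMap.id : CompactL2 →ₗ[ℂ] CompactL2)

lemma map_tmul (Φ : E →ₗ[ℂ] E) (T : E) (b : CompactL2) : map Φ (tmul T b) = tmul (Φ T) b := rfl

lemma map_add_left (Φ Ψ : E →ₗ[ℂ] E) : map (Φ + Ψ) = map Φ + map Ψ :=
  TensorProduct.map_add_left Φ Ψ LinearMap.id

lemma map_smul_left (c : ℂ) (Φ : E →ₗ[ℂ] E) : map (c • Φ) = c • map Φ :=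
  TensorProduct.map_smul_left c Φ LinearMap.id

lemma induction {p : AlgTensor E → Prop} (zero : p 0) (tmul : ∀ T b, p (tmul T b))
    (add : ∀ t t', p t → p t' → p (t + t')) (t : AlgTensor E) : p t :=
  TensorProduct.induction_on (motive := p) t zero tmul add

end AlgTensor

/-- The canonical map `T ⊗ b ↦ T ⊗ b` from the algebraic tensor product `E ⊙ K(ℓ²)` to
`B(K ⊗ ℓ²)`. -/
def algTensor (E : Submodule ℂ (K →L[ℂ] K)) :
    AlgTensor E →ₗ[ℂ] (TensorL2 K →L[ℂ] TensorL2 K) :=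
  AlgTensor.lift ((tensorOpₗ K).domRestrict₁₂ E CompactL2)

@[simp] lemma algTensor_tmul (E : Submodule ℂ (K →L[ℂ] K)) (T : E) (b : CompactL2) :
    algTensor E (AlgTensor.tmul T b) = tensorOp (T : K →L[ℂ] K) (b : SeqL2 →L[ℂ] SeqL2) := rfl

/-- The minimal tensor product `E ⊗ K(ℓ²)`: the closure of the algebraic tensor product in
`B(K ⊗ ℓ²)`. -/
def MinTensor (E : Submodule ℂ (K →L[ℂ] K)) : Type _ :=
  (LinearMap.range (algTensor E)).topologicalClosure

instance (E : Submodule ℂ (K →L[ℂ] K)) : NormedAddCommGroup (MinTensor E) :=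
  inferInstanceAs (NormedAddCommGroup (LinearMap.range (algTensor E)).topologicalClosure)

instance (E : Submodule ℂ (K →L[ℂ] K)) : NormedSpace ℂ (MinTensor E) :=
  inferInstanceAs (NormedSpace ℂ (LinearMap.range (algTensor E)).topologicalClosure)

instance (E : Submodule ℂ (K →L[ℂ] K)) : CompleteSpace (MinTensor E) :=
  (Submodule.isClosed_topologicalClosure (LinearMap.range (algTensor E))).completeSpace_coe

/-- The inclusion of `E ⊗ K(ℓ²)` in `B(K ⊗ ℓ²)`. -/
def MinTensor.val {E : Submodule ℂ (K →L[ℂ] K)} : MinTensor E →L[ℂ] TensorL2 K →L[ℂ] TensorL2 K :=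
  (LinearMap.range (algTensor E)).topologicalClosure.subtypeL

lemma MinTensor.norm_val {E : Submodule ℂ (K →L[ℂ] K)} (a : MinTensor E) : ‖a.val‖ = ‖a‖ := rfl

/-- The algebraic tensor product as a dense subspace of the minimal one. -/
def toMinTensor (E : Submodule ℂ (K →L[ℂ] K)) : AlgTensor E →ₗ[ℂ] MinTensor E :=
  (algTensor E).codRestrict (LinearMap.range (algTensor E)).topologicalClosure fun t =>
    Submodule.le_topologicalClosure _ (LinearMap.mem_range_self _ t)

lemma val_toMinTensor (E : Submodule ℂ (K →L[ℂ] K)) (t : AlgTensor E) :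
    (toMinTensor E t).val = algTensor E t := rfl

lemma norm_toMinTensor (E : Submodule ℂ (K →L[ℂ] K)) (t : AlgTensor E) :
    ‖toMinTensor E t‖ = ‖algTensor E t‖ := rfl

lemma denseRange_toMinTensor (E : Submodule ℂ (K →L[ℂ] K)) : DenseRange (toMinTensor E) := by
  have h : DenseRange fun t : LinearMap.range (algTensor E) =>
      (⟨t, Submodule.le_topologicalClosure _ t.2⟩ :
        (LinearMap.range (algTensor E)).topologicalClosure) :=
    (denseRange_inclusion_iff subset_closure).2 subset_rfl
  refine h.mono ?_
  rintro _ ⟨⟨_, t, rfl⟩, rfl⟩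
  exact ⟨t, rfl⟩

/-- The amplification `Φ ⊗ id : E ⊗ K(ℓ²) → E ⊗ K(ℓ²)` of a completely bounded map `Φ` on `E`:
the continuous extension of `T ⊗ b ↦ Φ(T) ⊗ b`. -/
def amplify {E : Submodule ℂ (K →L[ℂ] K)} (Φ : E →ₗ[ℂ] E) : MinTensor E →L[ℂ] MinTensor E :=
  LinearMap.extendOfNorm (toMinTensor E ∘ₗ AlgTensor.map Φ) (toMinTensor E)

/-! The extension exists: amplifications of completely bounded maps are bounded. -/

/-- The standard basis vectors of `ℓ²`. -/
def basisL2 (i : ℕ) : SeqL2 := L2.single i 1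

lemma inner_basisL2 (i : ℕ) (y : SeqL2) : ⟪basisL2 i, y⟫_ℂ = L2.coord i y := by
  refine (L2.hasSum_inner (basisL2 i) y).unique ?_
  convert hasSum_ite_eq i (L2.coord i y) using 2 with k
  rw [basisL2, L2.coord_single]
  split_ifs with h
  · subst h; simp
  · simp

/-- The isometry `Kⁿ → K ⊗ ℓ²`, `ξ ↦ ∑ ξ_i ⊗ e_i`. -/
def inclFin (n : ℕ) (ξ : L2 (Fin n) K) : TensorL2 K :=
  ∑ i : Fin n, tmulL2 (L2.coord i ξ) (basisL2 i)

lemma inner_inclFin {n : ℕ} (ξ η : L2 (Fin n) K) : ⟪inclFin n ξ, inclFin n η⟫_ℂ = ⟪ξ, η⟫_ℂ := by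
  rw [(L2.hasSum_inner ξ η).unique (hasSum_fintype _)]
  simp only [inclFin, sum_inner, inner_sum, inner_tmulL2, inner_basisL2]
  simp [basisL2, L2.coord_single, Fin.val_inj]

lemma norm_inclFin {n : ℕ} (ξ : L2 (Fin n) K) : ‖inclFin n ξ‖ = ‖ξ‖ := by
  rw [@norm_eq_sqrt_re_inner ℂ, @norm_eq_sqrt_re_inner ℂ _ _ _ _ ξ, inner_inclFin]

/-- The matrix coefficient `T ⊗ b ↦ b_{ij} T`. -/
def slice (E : Submodule ℂ (K →L[ℂ] K)) (i j : ℕ) : AlgTensor E →ₗ[ℂ] E :=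
  AlgTensor.lift
    (LinearMap.mk₂ ℂ (fun (T : E) (b : CompactL2) =>
        (L2.coord i ((b : SeqL2 →L[ℂ] SeqL2) (basisL2 j)) : ℂ) • T)
      (fun _ _ _ => smul_add _ _ _) (fun c T b => smul_comm _ _ _)
      (fun T b b' => by simp [add_smul]) (fun c T b => by simp [mul_smul]))

lemma slice_tmul (E : Submodule ℂ (K →L[ℂ] K)) (i j : ℕ) (T : E) (b : CompactL2) :
    slice E i j (AlgTensor.tmul T b) = (L2.coord i ((b : SeqL2 →L[ℂ] SeqL2) (basisL2 j)) : ℂ) • T := rfl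

lemma slice_map {E : Submodule ℂ (K →L[ℂ] K)} (Φ : E →ₗ[ℂ] E) (i j : ℕ) (t : AlgTensor E) :
    slice E i j (AlgTensor.map Φ t) = Φ (slice E i j t) := by
  induction t using AlgTensor.induction with
  | zero => simp
  | tmul T b => simp [slice_tmul, AlgTensor.map_tmul]
  | add t t' ht ht' => simp [ht, ht']

/-- The `n × n` upper left corner of an element of `E ⊙ K(ℓ²)`. -/
def corner (E : Submodule ℂ (K →L[ℂ] K)) (n : ℕ) (t : AlgTensor E) :
    Matrix (Fin n) (Fin n) E := Matrix.of fun i j => slice E i j t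

lemma inner_algTensor (E : Submodule ℂ (K →L[ℂ] K)) (t : AlgTensor E) {n : ℕ}
    (ξ η : L2 (Fin n) K) :
    ⟪inclFin n η, algTensor E t (inclFin n ξ)⟫_ℂ =
      ⟪η, blockOp ((corner E n t).map fun v => E.subtype v) ξ⟫_ℂ := by
  rw [(L2.hasSum_inner η _).unique (hasSum_fintype _)]
  simp only [blockOp_apply, inner_sum]
  induction t using AlgTensor.induction with
  | zero => simp [corner]
  | tmul T b =>
    simp only [inclFin, map_sum, algTensor_tmul, tensorOp_tmulL2, sum_inner, inner_sum,
      inner_tmulL2, inner_basisL2, corner, slice_tmul, Matrix.map_apply, Matrix.of_apply,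
      Submodule.subtype_apply, Submodule.coe_smul, smul_apply, inner_smul_right]
    rw [Finset.sum_comm]
    simp only [mul_comm]
  | add t t' ht ht' =>
    simp only [map_add, add_apply, inner_add_right, ht, ht', corner, Matrix.map_apply,
      Matrix.of_apply, Finset.sum_add_distrib]

lemma norm_corner_le (E : Submodule ℂ (K →L[ℂ] K)) (t : AlgTensor E) (n : ℕ) :
    ‖blockOp ((corner E n t).map fun v => E.subtype v)‖ ≤ ‖algTensor E t‖ := by
  refine ContinuousLinearMap.opNorm_le_bound _ (norm_nonneg _) fun ξ => ?_
  set η := blockOp ((corner E n t).map fun v => E.subtype v) ξ with hη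
  have h1 : ‖η‖ * ‖η‖ ≤ ‖η‖ * (‖algTensor E t‖ * ‖ξ‖) := by
    rw [← @inner_self_eq_norm_mul_norm ℂ]
    conv_lhs => rw [hη, ← hη, ← inner_algTensor]
    refine (RCLike.re_le_norm _).trans ((norm_inner_le_norm _ _).trans ?_)
    rw [norm_inclFin]
    refine mul_le_mul_of_nonneg_left ?_ (norm_nonneg _)
    simpa [norm_inclFin] using (algTensor E t).le_opNorm (inclFin n ξ)
  rcases (norm_nonneg η).eq_or_lt with h0 | h0
  · rw [← h0]; positivity
  · exact le_of_mul_le_mul_left h1 h0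

/-- Finitely supported sequences in `K` as vectors of `K ⊗ ℓ²`. -/
def inclFinsupp : (ℕ →₀ K) →ₗ[ℂ] TensorL2 K where
  toFun f := f.sum fun i k => tmulL2 k (basisL2 i)
  map_add' f g := Finsupp.sum_add_index' (fun i => by simp [tmulL2_apply])
    (fun i k k' => tmulL2_add _ _ _)
  map_smul' c f := by
    rw [Finsupp.sum_smul_index' (fun i => by simp [tmulL2_apply])]
    simp [Finsupp.smul_sum, tmulL2_smul]

lemma denseRange_inclFinsupp : DenseRange (inclFinsupp (K := K)) := by
  intro v
  refine mem_of_tmulL2_mem (LinearMap.range (inclFinsupp (K := K))).topologicalClosure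
    (Submodule.isClosed_topologicalClosure _) (fun x y => ?_) v
  refine (Submodule.isClosed_topologicalClosure _).mem_of_tendsto
    ((y.hasSum_single).mapL (tmulL2 x)) (Filter.Eventually.of_forall fun s => ?_)
  refine Submodule.sum_mem _ fun i _ => Submodule.le_topologicalClosure _ ?_
  refine ⟨Finsupp.single i ((L2.coord i y : ℂ) • x), ?_⟩
  have : L2.single i (L2.coord i y) = (L2.coord i y : ℂ) • basisL2 i := by
    rw [basisL2, ← map_smul, smul_eq_mul, mul_one]
  rw [this, map_smul, ← tmulL2_smul]
  simp [inclFinsupp, tmulL2_apply]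

lemma exists_inclFin (f g : ℕ →₀ K) : ∃ (n : ℕ) (ξ η : L2 (Fin n) K),
    inclFinsupp f = inclFin n ξ ∧ inclFinsupp g = inclFin n η := by
  obtain ⟨n, hn⟩ := (f.support ∪ g.support).exists_nat_subset_range
  have key : ∀ h : ℕ →₀ K, h.support ⊆ Finset.range n → inclFinsupp h =
      inclFin n (L2.mk (fun i : Fin n => h i) (L2.memlp_iff.2 (hasSum_fintype _).summable)) := by
    intro h hh
    simp only [inclFinsupp, inclFin, LinearMap.coe_mk, AddHom.coe_mk, L2.coord_mk]
    rw [Finsupp.sum_of_support_subset h hh _ (fun i _ => by simp [tmulL2_apply]),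
      Finset.sum_range]
  exact ⟨n, _, _, key f (Finset.union_subset_left hn), key g (Finset.union_subset_right hn)⟩

lemma norm_algTensor_le (E : Submodule ℂ (K →L[ℂ] K)) (t : AlgTensor E) {M : ℝ} (hM : 0 ≤ M)
    (h : ∀ n, ‖blockOp ((corner E n t).map fun v => E.subtype v)‖ ≤ M) : ‖algTensor E t‖ ≤ M := by
  have key : ∀ v u : TensorL2 K, ‖⟪v, algTensor E t u⟫_ℂ‖ ≤ ‖v‖ * (M * ‖u‖) := by
    intro v u
    refine denseRange_inclFinsupp.induction_on₂
      (p := fun v u => ‖⟪v, algTensor E t u⟫_ℂ‖ ≤ ‖v‖ * (M * ‖u‖)) ?_ (fun g f => ?_) v u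
    · exact isClosed_le (by fun_prop) (by fun_prop)
    · obtain ⟨n, ξ, η, hf, hg⟩ := exists_inclFin f g
      rw [hf, hg, inner_algTensor, norm_inclFin, norm_inclFin]
      exact (norm_inner_le_norm _ _).trans (mul_le_mul_of_nonneg_left
        (ContinuousLinearMap.le_of_opNorm_le _ (h n) ξ) (norm_nonneg _))
  refine ContinuousLinearMap.opNorm_le_bound _ hM fun u => ?_
  have h1 := key (algTensor E t u) u
  rw [inner_self_eq_norm_sq_to_K] at h1
  rcases (norm_nonneg (algTensor E t u)).eq_or_lt with h0 | h0
  · rw [← h0]; positivity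
  · refine le_of_mul_le_mul_left (le_trans (le_of_eq ?_) h1) h0
    simp [sq]

lemma CBBound.norm_toMinTensor_le {E : Submodule ℂ (K →L[ℂ] K)} {Φ : E →ₗ[ℂ] E} {C : ℝ}
    (h : CBBound E.subtype Φ C) (t : AlgTensor E) :
    ‖(toMinTensor E ∘ₗ AlgTensor.map Φ) t‖ ≤ C * ‖toMinTensor E t‖ := by
  refine norm_algTensor_le E _ (mul_nonneg h.1 (norm_nonneg _)) fun n => ?_
  have h2 := h.2 n (corner E n t)
  refine le_trans (le_of_eq ?_) (h2.trans (mul_le_mul_of_nonneg_left (norm_corner_le E t n) h.1))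
  congr 2
  ext i j : 2
  simp [corner, slice_map]

lemma CBBound.amplify_apply {E : Submodule ℂ (K →L[ℂ] K)} {Φ : E →ₗ[ℂ] E} {C : ℝ}
    (h : CBBound E.subtype Φ C) (t : AlgTensor E) :
    amplify Φ (toMinTensor E t) = toMinTensor E (AlgTensor.map Φ t) :=
  LinearMap.extendOfNorm_eq (denseRange_toMinTensor E) ⟨C, h.norm_toMinTensor_le⟩ t

lemma CBBound.norm_amplify_le {E : Submodule ℂ (K →L[ℂ] K)} {Φ : E →ₗ[ℂ] E} {C : ℝ}
    (h : CBBound E.subtype Φ C) (a : MinTensor E) : ‖amplify Φ a‖ ≤ C * ‖a‖ :=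
  LinearMap.norm_extendOfNorm_apply_le (denseRange_toMinTensor E) C h.norm_toMinTensor_le a

lemma minTensor_ext {E : Submodule ℂ (K →L[ℂ] K)} {X : Type*} [TopologicalSpace X] [T2Space X]
    {P Q : MinTensor E → X} (hP : Continuous P) (hQ : Continuous Q)
    (h : ∀ t, P (toMinTensor E t) = Q (toMinTensor E t)) : P = Q :=
  (denseRange_toMinTensor E).equalizer hP hQ (funext h)

lemma amplify_add {E : Submodule ℂ (K →L[ℂ] K)} {Φ Ψ : E →ₗ[ℂ] E} (h : IsCB E.subtype Φ)
    (h' : IsCB E.subtype Ψ) (a : MinTensor E) :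
    amplify (Φ + Ψ) a = amplify Φ a + amplify Ψ a := by
  refine congrFun (minTensor_ext (E := E) (P := fun a => amplify (Φ + Ψ) a)
    (Q := fun a => amplify Φ a + amplify Ψ a) (amplify (Φ + Ψ)).continuous
    ((amplify Φ).continuous.add (amplify Ψ).continuous) fun t => ?_) a
  rw [(h.bound.add h'.bound).amplify_apply, h.bound.amplify_apply, h'.bound.amplify_apply,
    AlgTensor.map_add_left, LinearMap.add_apply, map_add]

lemma amplify_smul {E : Submodule ℂ (K →L[ℂ] K)} {Φ : E →ₗ[ℂ] E} (c : ℂ) (h : IsCB E.subtype Φ)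
    (a : MinTensor E) : amplify (c • Φ) a = c • amplify Φ a := by
  refine congrFun (minTensor_ext (E := E) (P := fun a => amplify (c • Φ) a)
    (Q := fun a => c • amplify Φ a) (amplify (c • Φ)).continuous
    ((amplify Φ).continuous.const_smul c) fun t => ?_) a
  rw [(h.bound.smul c).amplify_apply, h.bound.amplify_apply, AlgTensor.map_smul_left,
    LinearMap.smul_apply, (toMinTensor E).map_smul]

end Tensor

/-! ### Bicommutants, von Neumann tensor products, normal functionals -/

section VonNeumann

variable {K : Type*} [NormedAddCommGroup K] [InnerProductSpace ℂ K]

/-- The bicommutant `S''` of a set of operators. -/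
def bicommutant (S : Set (K →L[ℂ] K)) : Subalgebra ℂ (K →L[ℂ] K) :=
  Subalgebra.centralizer ℂ (Subalgebra.centralizer ℂ S : Set (K →L[ℂ] K))

lemma subset_bicommutant (S : Set (K →L[ℂ] K)) : S ⊆ bicommutant S :=
  Set.subset_centralizer_centralizer

lemma isClosed_bicommutant (S : Set (K →L[ℂ] K)) :
    IsClosed (bicommutant S : Set (K →L[ℂ] K)) := Set.isClosed_centralizer _

/-- The von Neumann algebra tensor product `M ⊗̄ B(ℓ²)` of a von Neumann algebra `M` on `K` with
`B(ℓ²)`: the von Neumann algebra on `K ⊗ ℓ²` generated by the operators `T ⊗ b`. -/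
def vnTensor (M : Subalgebra ℂ (K →L[ℂ] K)) : Subalgebra ℂ (TensorL2 K →L[ℂ] TensorL2 K) :=
  bicommutant {x | ∃ T ∈ M, ∃ b : SeqL2 →L[ℂ] SeqL2, x = tensorOp T b}

/-- The ultraweak (σ-weak) topology on `B(K)`: the coarsest topology for which all functionals
`T ↦ ∑ₙ ⟪ξₙ, T ηₙ⟫` with `∑ₙ ‖ξₙ‖² < ∞` and `∑ₙ ‖ηₙ‖² < ∞` are continuous. -/
def ultraweakTopology (K : Type*) [NormedAddCommGroup K] [InnerProductSpace ℂ K] :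
    TopologicalSpace (K →L[ℂ] K) :=
  ⨅ p : L2 ℕ K × L2 ℕ K, TopologicalSpace.induced
    (fun T => ∑' n, ⟪L2.coord n p.1, T (L2.coord n p.2)⟫_ℂ) inferInstance

/-- A bounded functional on a von Neumann algebra is normal, that is, belongs to the predual, if
it is ultraweakly continuous. -/
def IsNormal {N : Subalgebra ℂ (K →L[ℂ] K)} (f : N →L[ℂ] ℂ) : Prop :=
  @Continuous N ℂ ((ultraweakTopology K).induced Subtype.val) inferInstance f

lemma val_mem_vnTensor (E : Submodule ℂ (K →L[ℂ] K)) (a : MinTensor E) :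
    a.val ∈ vnTensor (bicommutant (E : Set (K →L[ℂ] K))) := by
  refine (denseRange_toMinTensor E).induction_on a
    ((isClosed_bicommutant _).preimage MinTensor.val.continuous) fun t => ?_
  rw [val_toMinTensor]
  induction t using AlgTensor.induction with
  | zero => rw [map_zero]; exact zero_mem _
  | tmul T b =>
    exact subset_bicommutant _ ⟨T, subset_bicommutant _ T.2, b, algTensor_tmul E T b⟩
  | add t t' ht ht' => rw [map_add]; exact add_mem ht ht'

/-- The inclusion `E ⊗ K(ℓ²) ⊆ E'' ⊗̄ B(ℓ²)`. -/
def MinTensor.toVN {E : Submodule ℂ (K →L[ℂ] K)} (a : MinTensor E) :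
    vnTensor (bicommutant (E : Set (K →L[ℂ] K))) := ⟨a.val, val_mem_vnTensor E a⟩

lemma MinTensor.norm_toVN {E : Submodule ℂ (K →L[ℂ] K)} (a : MinTensor E) : ‖a.toVN‖ = ‖a‖ := rfl

lemma MinTensor.toVN_add {E : Submodule ℂ (K →L[ℂ] K)} (a b : MinTensor E) :
    (a + b).toVN = a.toVN + b.toVN := rfl

lemma MinTensor.toVN_smul {E : Submodule ℂ (K →L[ℂ] K)} (c : ℂ) (a : MinTensor E) :
    (c • a).toVN = c • a.toVN := rfl

end VonNeumann

/-! ### C*-dynamical systems and Herz–Schur multipliers -/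

/-- A C*-dynamical system `(A, G, α)` with `G` discrete, where the C*-algebra `A` acts faithfully
on the Hilbert space `H`. -/
structure CStarSystem (A G H : Type*) [NonUnitalCStarAlgebra A] [Group G] [NormedAddCommGroup H]
    [InnerProductSpace ℂ H] [CompleteSpace H] where
  /-- The representation of `A` on `H`. -/
  rep : A →⋆ₙₐ[ℂ] (H →L[ℂ] H)
  rep_injective : Function.Injective rep
  /-- The action `α` of `G` on `A` by automorphisms. -/
  action : G →* (A ≃⋆ₐ[ℂ] A)

namespace CStarSystem

variable {A G H : Type*} [NonUnitalCStarAlgebra A] [Group G] [NormedAddCommGroup H]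
  [InnerProductSpace ℂ H] [CompleteSpace H] (D : CStarSystem A G H)

/-- The embedding `A ⊆ B(H)` as a linear map; it makes `A` an operator space. -/
def repₗ : A →ₗ[ℂ] (H →L[ℂ] H) where
  toFun := D.rep
  map_add' := map_add D.rep
  map_smul' := map_smul D.rep

lemma norm_rep_le (a : A) : ‖D.rep a‖ ≤ ‖a‖ := NonUnitalStarAlgHom.norm_apply_le D.rep a

lemma norm_rep (a : A) : ‖D.rep a‖ = ‖a‖ := NonUnitalStarAlgHom.norm_map D.rep D.rep_injective a

lemma norm_action (s : G) (a : A) : ‖D.action s a‖ = ‖a‖ :=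
  NonUnitalStarAlgHom.norm_map (D.action s) (D.action s).injective a

/-- The representation `π` of `A` on `ℓ²(G, H)`: `(π(a)ξ)(s) = α_s⁻¹(a) ξ(s)`. -/
def reprA (a : A) : L2 G H →L[ℂ] L2 G H :=
  L2.diagOp (fun s => D.rep (D.action s⁻¹ a)) ‖a‖ fun _ =>
    (D.norm_rep_le _).trans (D.norm_action _ _).le

/-- The representation `λ` of `G` on `ℓ²(G, H)`: `(λ_r ξ)(s) = ξ(r⁻¹ s)`. -/
def reprG (H : Type*) [NormedAddCommGroup H] [InnerProductSpace ℂ H] (r : G) :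
    L2 G H →L[ℂ] L2 G H := L2.permOp (Equiv.mulLeft r⁻¹)

lemma coord_reprA (a : A) (ξ : L2 G H) (s : G) :
    L2.coord s (D.reprA a ξ) = D.rep (D.action s⁻¹ a) (L2.coord s ξ) := rfl

lemma coord_reprG (r : G) (ξ : L2 G H) (s : G) :
    L2.coord s (reprG H r ξ) = L2.coord (r⁻¹ * s) ξ := rfl

lemma reprA_add (a b : A) : D.reprA (a + b) = D.reprA a + D.reprA b := by
  ext ξ s
  simp [coord_reprA]

lemma reprA_smul (c : ℂ) (a : A) : D.reprA (c • a) = c • D.reprA a := by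
  ext ξ s
  simp [coord_reprA]

lemma norm_reprA_le (a : A) : ‖D.reprA a‖ ≤ ‖a‖ := by
  refine ContinuousLinearMap.opNorm_le_bound _ (norm_nonneg _) fun ξ => ?_
  refine L2.norm_le_of_coord_le (Equiv.refl G) (norm_nonneg _) fun s => ?_
  rw [coord_reprA]
  exact ContinuousLinearMap.le_of_opNorm_le _ ((D.norm_rep_le _).trans (D.norm_action _ _).le) _

lemma norm_reprG_le (r : G) : ‖reprG H r‖ ≤ 1 :=
  ContinuousLinearMap.opNorm_le_bound _ zero_le_one fun ξ =>
    L2.norm_le_of_coord_le (Equiv.mulLeft r⁻¹) zero_le_one fun s => by simp [coord_reprG]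

/-- The Banach space `ℓ¹(G, A)`, as a vector space of functions. -/
def ell1 (G A : Type*) [NonUnitalCStarAlgebra A] : Submodule ℂ (G → A) where
  carrier := {f | Summable fun s => ‖f s‖}
  zero_mem' := by simp
  add_mem' hf hg := (hf.add hg).of_nonneg_of_le (fun _ => norm_nonneg _) fun _ => norm_add_le _ _
  smul_mem' c f hf := by
    simpa [norm_smul] using hf.mul_left ‖c‖

/-- The integrated form `(π ⋊ λ)(f) = ∑ₛ π(f(s)) λ_s`, for `f ∈ ℓ¹(G, A)`; the series converges
absolutely in the operator norm. -/
def integrated (f : G → A) : L2 G H →L[ℂ] L2 G H := ∑' s, D.reprA (f s) * reprG H s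

lemma summable_integrated {f : G → A} (hf : f ∈ ell1 G A) :
    Summable fun s => D.reprA (f s) * reprG H s := by
  refine Summable.of_norm_bounded hf fun s => (norm_mul_le _ _).trans ?_
  exact (mul_le_mul (D.norm_reprA_le _) (norm_reprG_le s) (norm_nonneg _) (norm_nonneg _)).trans
    (mul_one _).le

lemma single_mem_ell1 [DecidableEq G] (r : G) (a : A) : Pi.single r a ∈ ell1 G A :=
  summable_of_ne_finset_zero (s := {r}) fun s hs => by
    have : s ≠ r := by simpa using hs
    simp [this]

lemma integrated_single [DecidableEq G] (r : G) (a : A) :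
    D.integrated (Pi.single r a) = D.reprA a * reprG H r := by
  have h0 : D.reprA 0 = 0 := by simpa using D.reprA_smul 0 0
  rw [integrated, tsum_eq_single r fun s hs => by rw [Pi.single_eq_of_ne hs, h0, zero_mul]]
  simp

lemma norm_reprA_mul (a : A) (r : G) : ‖D.reprA a * reprG H r‖ = ‖a‖ := by
  classical
  refine le_antisymm ((norm_mul_le _ _).trans ((mul_le_mul (D.norm_reprA_le _) (norm_reprG_le r)
    (norm_nonneg _) (norm_nonneg _)).trans (mul_one _).le)) ?_
  rw [← D.norm_rep a]
  refine ContinuousLinearMap.opNorm_le_bound _ (norm_nonneg _) fun k => ?_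
  have h1 : L2.coord 1 ((D.reprA a * reprG H r) (L2.single r⁻¹ k)) = D.rep a k := by
    simp [coord_reprA, coord_reprG, L2.coord_single]
  rw [← h1, ← L2.norm_single (r⁻¹ : G) k]
  exact (L2.norm_coord_le _ _).trans (ContinuousLinearMap.le_opNorm _ _)

/-- The integrated form as a linear map on `ℓ¹(G, A)`. -/
def integratedₗ : ell1 G A →ₗ[ℂ] (L2 G H →L[ℂ] L2 G H) where
  toFun f := D.integrated f
  map_add' f g := by
    rw [integrated, integrated, integrated,
      ← (D.summable_integrated f.2).tsum_add (D.summable_integrated g.2)]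
    simp [reprA_add, add_mul]
  map_smul' c f := by
    simp only [integrated, RingHom.id_apply]
    rw [← (D.summable_integrated f.2).tsum_const_smul c]
    simp [reprA_smul]

/-- The reduced crossed product `A ⋊_{r} G`: the norm closure of `(π ⋊ λ)(ℓ¹(G, A))` in
`B(ℓ²(G, H))`. -/
def crossedProduct : Submodule ℂ (L2 G H →L[ℂ] L2 G H) :=
  (LinearMap.range D.integratedₗ).topologicalClosure

/-- The integrated form with values in the reduced crossed product. -/
def toCrossedProduct : ell1 G A →ₗ[ℂ] D.crossedProduct :=
  D.integratedₗ.codRestrict D.crossedProduct fun f =>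
    Submodule.le_topologicalClosure _ (LinearMap.mem_range_self _ f)

/-- The map `Φ` on the reduced crossed product satisfies
`Φ((π ⋊ λ)(f)) = (π ⋊ λ)(F · f)` for `f ∈ ℓ¹(G, A)`, where `(F · f)(r) = F(r)(f(r))`. -/
def Implements (F : G → A →L[ℂ] A) (Φ : D.crossedProduct →ₗ[ℂ] D.crossedProduct) : Prop :=
  ∀ f : ell1 G A, (Φ (D.toCrossedProduct f) : L2 G H →L[ℂ] L2 G H) =
    D.integrated fun r => F r ((f : G → A) r)

/-- Herz–Schur `(A, G, α)`-multipliers: bounded functions `F : G → CB(A)` for which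
`(π ⋊ λ)(f) ↦ (π ⋊ λ)(F · f)` extends to a completely bounded map on the reduced crossed
product. -/
def IsHerzSchurMultiplier (F : G → A →L[ℂ] A) : Prop :=
  (∃ C, ∀ r, CBBound D.repₗ (F r).toLinearMap C) ∧
    ∃ Φ : D.crossedProduct →ₗ[ℂ] D.crossedProduct,
      IsCB D.crossedProduct.subtype Φ ∧ D.Implements F Φ

/-- `F` is central: every `F(r)` is the multiplication by an element of the centre of the
multiplier algebra of `A`. -/
def IsCentral (F : G → A →L[ℂ] A) : Prop :=
  ∀ r, ∃ m ∈ Subalgebra.center ℂ 𝓜(ℂ, A), F r = m.fst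

variable {D}

lemma mem_ell1_of_bound {F : G → A →L[ℂ] A} {C : ℝ}
    (hF : ∀ r, CBBound D.repₗ (F r).toLinearMap C) {f : G → A} (hf : f ∈ ell1 G A) :
    (fun r => F r (f r)) ∈ ell1 G A := by
  refine Summable.of_nonneg_of_le (fun _ => norm_nonneg _) (fun r => ?_)
    (Summable.mul_left C (show Summable fun r => ‖f r‖ from hf))
  have := (hF r).norm_le (f r)
  rwa [show D.repₗ (f r) = D.rep (f r) from rfl, D.norm_rep, show D.repₗ ((F r).toLinearMap (f r)) =
    D.rep (F r (f r)) from rfl, D.norm_rep] at this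

lemma Implements.add {F F' : G → A →L[ℂ] A} {Φ Φ' : D.crossedProduct →ₗ[ℂ] D.crossedProduct}
    {C C' : ℝ} (hF : ∀ r, CBBound D.repₗ (F r).toLinearMap C)
    (hF' : ∀ r, CBBound D.repₗ (F' r).toLinearMap C')
    (h : D.Implements F Φ) (h' : D.Implements F' Φ') : D.Implements (F + F') (Φ + Φ') := by
  intro f
  rw [LinearMap.add_apply, Submodule.coe_add, h f, h' f]
  exact (D.integratedₗ.map_add ⟨_, mem_ell1_of_bound hF f.2⟩ ⟨_, mem_ell1_of_bound hF' f.2⟩).symm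

lemma Implements.smul {F : G → A →L[ℂ] A} {Φ : D.crossedProduct →ₗ[ℂ] D.crossedProduct}
    {C : ℝ} (hF : ∀ r, CBBound D.repₗ (F r).toLinearMap C) (c : ℂ)
    (h : D.Implements F Φ) : D.Implements (c • F) (c • Φ) := by
  intro f
  rw [LinearMap.smul_apply, Submodule.coe_smul, h f]
  exact (D.integratedₗ.map_smul c ⟨_, mem_ell1_of_bound hF f.2⟩).symm

/-- The map implemented by `F` is determined by `F`. -/
lemma Implements.unique {F : G → A →L[ℂ] A} {Φ Φ' : D.crossedProduct →ₗ[ℂ] D.crossedProduct}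
    (hΦ : IsCB D.crossedProduct.subtype Φ) (hΦ' : IsCB D.crossedProduct.subtype Φ')
    (h : D.Implements F Φ) (h' : D.Implements F Φ') : Φ = Φ' := by
  have hc : ∀ {Ψ : D.crossedProduct →ₗ[ℂ] D.crossedProduct}, IsCB D.crossedProduct.subtype Ψ →
      Continuous Ψ := fun {Ψ} hΨ =>
    (LinearMap.mkContinuous Ψ _ fun x => hΨ.bound.norm_le x).continuous
  have hd : DenseRange fun t : LinearMap.range D.integratedₗ =>
      (⟨t, Submodule.le_topologicalClosure _ t.2⟩ : D.crossedProduct) :=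
    (denseRange_inclusion_iff subset_closure).2 subset_rfl
  apply LinearMap.coe_injective
  refine hd.equalizer (hc hΦ) (hc hΦ') (funext ?_)
  rintro ⟨_, f, rfl⟩
  exact Subtype.ext ((h f).trans (h' f).symm)

variable (D)

/-- The vector space of central Herz–Schur `(A, G, α)`-multipliers. -/
def centralSubmodule : Submodule ℂ (G → A →L[ℂ] A) where
  carrier := {F | D.IsHerzSchurMultiplier F ∧ IsCentral F}
  zero_mem' := by
    refine ⟨⟨⟨0, fun r => CBBound.zero⟩, 0, ⟨0, CBBound.zero⟩, fun f => ?_⟩, fun r =>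
      ⟨0, zero_mem _, rfl⟩⟩
    exact (D.integratedₗ.map_zero).symm
  add_mem' := by
    rintro F F' ⟨⟨⟨C, hC⟩, Φ, hΦ, hF⟩, hc⟩ ⟨⟨⟨C', hC'⟩, Φ', hΦ', hF'⟩, hc'⟩
    refine ⟨⟨⟨C + C', fun r => (hC r).add (hC' r)⟩, Φ + Φ', ⟨_, hΦ.bound.add hΦ'.bound⟩,
      hF.add hC hC' hF'⟩, fun r => ?_⟩
    obtain ⟨m, hm, h⟩ := hc r
    obtain ⟨m', hm', h'⟩ := hc' r
    exact ⟨m + m', add_mem hm hm', by simp [h, h']⟩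
  smul_mem' := by
    rintro c F ⟨⟨⟨C, hC⟩, Φ, hΦ, hF⟩, hc⟩
    refine ⟨⟨⟨‖c‖ * C, fun r => (hC r).smul c⟩, c • Φ, ⟨_, hΦ.bound.smul c⟩, hF.smul hC c⟩,
      fun r => ?_⟩
    obtain ⟨m, hm, h⟩ := hc r
    exact ⟨c • m, Subalgebra.smul_mem _ hm c, by simp [h]⟩

/-- The space `𝔖_cent(A, G, α)` of central Herz–Schur `(A, G, α)`-multipliers. -/
def CentralMultiplier : Type _ := D.centralSubmodule

namespace CentralMultiplier

variable {D}

instance : AddCommGroup D.CentralMultiplier := inferInstanceAs (AddCommGroup D.centralSubmodule)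

instance : Module ℂ D.CentralMultiplier := inferInstanceAs (Module ℂ D.centralSubmodule)

/-- The underlying function `G → B(A)`. -/
def toFun (F : D.CentralMultiplier) : G → A →L[ℂ] A := F.1

lemma toFun_add (F F' : D.CentralMultiplier) : (F + F').toFun = F.toFun + F'.toFun := rfl

lemma toFun_smul (c : ℂ) (F : D.CentralMultiplier) : (c • F).toFun = c • F.toFun := rfl

lemma cb_bound (F : D.CentralMultiplier) : ∃ C, ∀ r, CBBound D.repₗ (F.toFun r).toLinearMap C :=
  F.2.1.1

/-- The completely bounded map `S_F` on the reduced crossed product. -/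
def S (F : D.CentralMultiplier) : D.crossedProduct →ₗ[ℂ] D.crossedProduct := F.2.1.2.choose

lemma isCB_S (F : D.CentralMultiplier) : IsCB D.crossedProduct.subtype F.S :=
  F.2.1.2.choose_spec.1

lemma implements_S (F : D.CentralMultiplier) : D.Implements F.toFun F.S :=
  F.2.1.2.choose_spec.2

lemma S_add (F F' : D.CentralMultiplier) : (F + F').S = F.S + F'.S := by
  obtain ⟨C, hC⟩ := F.cb_bound
  obtain ⟨C', hC'⟩ := F'.cb_bound
  exact (F + F').implements_S.unique (F + F').isCB_S ⟨_, F.isCB_S.bound.add F'.isCB_S.bound⟩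
    (F.implements_S.add hC hC' F'.implements_S)

lemma S_smul (c : ℂ) (F : D.CentralMultiplier) : (c • F).S = c • F.S := by
  obtain ⟨C, hC⟩ := F.cb_bound
  exact (c • F).implements_S.unique (c • F).isCB_S ⟨_, F.isCB_S.bound.smul c⟩
    (F.implements_S.smul hC c)

/-- The norm `‖F‖_m = ‖S_F‖_cb`. -/
instance : Norm D.CentralMultiplier := ⟨fun F => cbNorm D.crossedProduct.subtype F.S⟩

lemma norm_def (F : D.CentralMultiplier) : ‖F‖ = cbNorm D.crossedProduct.subtype F.S := rfl

lemma norm_S_le (F : D.CentralMultiplier) (x : D.crossedProduct) : ‖F.S x‖ ≤ ‖F‖ * ‖x‖ :=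
  F.isCB_S.bound.norm_le x

/-- The values of a multiplier are bounded by its norm. -/
lemma norm_toFun_le (F : D.CentralMultiplier) (r : G) (a : A) : ‖F.toFun r a‖ ≤ ‖F‖ * ‖a‖ := by
  classical
  have h1 : (F.S (D.toCrossedProduct ⟨Pi.single r a, single_mem_ell1 r a⟩) :
      L2 G H →L[ℂ] L2 G H) = D.reprA (F.toFun r a) * reprG H r := by
    rw [F.implements_S, ← D.integrated_single]
    congr 1
    ext s
    rcases eq_or_ne s r with rfl | h
    · simp
    · simp [h]
  have h2 := F.norm_S_le (D.toCrossedProduct ⟨Pi.single r a, single_mem_ell1 r a⟩)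
  rw [Submodule.coe_norm, h1, Submodule.coe_norm,
    show (D.toCrossedProduct ⟨Pi.single r a, single_mem_ell1 r a⟩ : L2 G H →L[ℂ] L2 G H) =
      D.reprA a * reprG H r from D.integrated_single r a, D.norm_reprA_mul, D.norm_reprA_mul] at h2
  exact h2

instance : NormedAddCommGroup D.CentralMultiplier :=
  NormedAddCommGroup.ofCore (𝕜 := ℂ)
    { norm_nonneg := fun F => cbNorm_nonneg
      norm_smul := fun c F => by
        rw [norm_def, S_smul, F.isCB_S.cbNorm_smul, norm_def]
      norm_triangle := fun F F' => by
        rw [norm_def, S_add]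
        exact F.isCB_S.cbNorm_add_le F'.isCB_S
      norm_eq_zero_iff := fun F => by
        constructor
        · intro h
          refine Subtype.ext (funext fun r => ContinuousLinearMap.ext fun a => ?_)
          have := F.norm_toFun_le r a
          rw [h, zero_mul] at this
          exact norm_le_zero_iff.1 this
        · rintro rfl
          have h0 : (0 : D.CentralMultiplier).S = 0 := by
            simpa using S_smul (0 : ℂ) (0 : D.CentralMultiplier)
          rw [norm_def, h0]
          exact le_antisymm CBBound.zero.cbNorm_le cbNorm_nonneg }

instance : NormedSpace ℂ D.CentralMultiplier where
  norm_smul_le c F := by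
    rw [norm_def, S_smul, F.isCB_S.cbNorm_smul, norm_def]

end CentralMultiplier

/-- The functional `ω_{a,f}(F) = f((S_F ⊗ id)(a))` on the central multipliers, for
`a ∈ (A ⋊_r G) ⊗ K(ℓ²)` and a bounded functional `f` on `(A ⋊_r G)'' ⊗̄ B(ℓ²)`. -/
def omega (a : MinTensor D.crossedProduct)
    (f : vnTensor (bicommutant (D.crossedProduct : Set (L2 G H →L[ℂ] L2 G H))) →L[ℂ] ℂ) :
    StrongDual ℂ D.CentralMultiplier :=
  LinearMap.mkContinuous
    { toFun := fun F => f (amplify F.S a).toVN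
      map_add' := fun F F' => by
        rw [F.S_add, amplify_add F.isCB_S F'.isCB_S, MinTensor.toVN_add, map_add]
      map_smul' := fun c F => by
        rw [F.S_smul, amplify_smul c F.isCB_S, MinTensor.toVN_smul, map_smul, RingHom.id_apply] }
    (‖f‖ * ‖a‖) fun F => by
      refine (f.le_opNorm _).trans ?_
      rw [MinTensor.norm_toVN, mul_assoc, mul_comm ‖a‖]
      exact mul_le_mul_of_nonneg_left (F.isCB_S.bound.norm_amplify_le a) (norm_nonneg _)

end CStarSystem

/-! ### The predual for discrete transformation systems -/

section Discrete

variable {Z G H : Type*} [TopologicalSpace Z] [DiscreteTopology Z] [Group G]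
  [NormedAddCommGroup H] [InnerProductSpace ℂ H] [CompleteSpace H]

/-- The function `δ_z ∈ C₀(Z)`, for discrete `Z`. -/
def delta (z : Z) : C₀(Z, ℂ) where
  toFun := Set.indicator {z} 1
  continuous_toFun := continuous_of_discreteTopology
  zero_at_infty' := by
    refine tendsto_const_nhds.congr' ?_
    filter_upwards [(isCompact_singleton (x := z)).compl_mem_cocompact] with w hw
    exact (Set.indicator_of_notMem hw _).symm

lemma norm_delta_le (z : Z) : ‖delta z‖ ≤ 1 := by
  rw [← ZeroAtInftyContinuousMap.norm_toBCF_eq_norm,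
    BoundedContinuousFunction.norm_le zero_le_one]
  intro w
  change ‖Set.indicator {z} (1 : Z → ℂ) w‖ ≤ 1
  by_cases h : w ∈ ({z} : Set Z) <;> simp [h]

lemma norm_apply_le_norm (a : C₀(Z, ℂ)) (z : Z) : ‖a z‖ ≤ ‖a‖ := by
  rw [← ZeroAtInftyContinuousMap.norm_toBCF_eq_norm]
  exact a.toBCF.norm_coe_le_norm z

variable (D : CStarSystem C₀(Z, ℂ) G H)

/-- Evaluation of the function `φ : Z × G → ℂ` belonging to a central multiplier `F`, that is
`F(s)(a)(z) = φ(z, s) a(z)`. -/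
def evalAt (p : Z × G) : StrongDual ℂ D.CentralMultiplier :=
  LinearMap.mkContinuous
    { toFun := fun F => F.toFun p.2 (delta p.1) p.1
      map_add' := fun F F' => by simp [CStarSystem.CentralMultiplier.toFun_add]
      map_smul' := fun c F => by simp [CStarSystem.CentralMultiplier.toFun_smul] }
    1 fun F => by
      rw [one_mul]
      exact (norm_apply_le_norm _ _).trans ((F.norm_toFun_le p.2 (delta p.1)).trans
        (mul_le_of_le_one_right (norm_nonneg _) (norm_delta_le p.1)))

/-- Finitely supported functions `ψ` on `Z × G` as functionals on the central multipliers: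
`⟨ψ, φ⟩ = ∑ ψ(z, s) φ(z, s)`. -/
def pairing : (Z × G →₀ ℂ) →ₗ[ℂ] StrongDual ℂ D.CentralMultiplier :=
  Finsupp.linearCombination ℂ (evalAt D)

/-- The space `Q_cent(Z, G, α)`: the completion of `C_c(Z × G)` in the dual of the space of
central multipliers, that is, its norm closure there. -/
def Qcent : Type _ := (LinearMap.range (pairing D)).topologicalClosure

instance : NormedAddCommGroup (Qcent D) :=
  inferInstanceAs (NormedAddCommGroup (LinearMap.range (pairing D)).topologicalClosure)

instance : NormedSpace ℂ (Qcent D) :=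
  inferInstanceAs (NormedSpace ℂ (LinearMap.range (pairing D)).topologicalClosure)

/-- The inclusion of `Q_cent(Z, G, α)` in the dual of the space of central multipliers. -/
def Qcent.toDual : Qcent D →L[ℂ] StrongDual ℂ D.CentralMultiplier :=
  (LinearMap.range (pairing D)).topologicalClosure.subtypeL

end Discrete

end HerzSchur
end

open HerzSchur

open scoped TensorProduct ZeroAtInfty InnerProductSpace MultiplierAlgebra Topology

noncomputable section

/-! The elements `π(δ_z)λ_s` span a dense subspace of the crossed product, and they are common
eigenvectors of all the maps `S_F`, with eigenvalue `φ(z,s)` (`S_coeff_delta`). Hence for `a =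
π(δ_z)λ_s ⊗ b` the functional `ω_{a,f}` is a multiple of a point evaluation of `φ`. Since `ω_{a,f}`
depends norm continuously on `a`, it lies in `Q_cent` for every `a` (`omega_mem`).

The same eigenvectors give the duality. Let `Λ` be a bounded functional on `𝔖*`, the dual of the
space of multipliers. The sesquilinear forms `(η, ξ) ↦ Λ(F ↦ ⟪η, S_F(T) ξ⟫)` define operators
`Φ(T)`. The map `Φ` has completely bounded norm at most `‖Λ‖`, and each generator is an eigenvector
whose eigenvalue is `Λ` of the point evaluation. So `Φ` is implemented by a central multiplier, and
`Λ` is evaluation at that multiplier on all of `Q_cent` (`exists_multiplier_of_bidual`,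
`exists_multiplier_eq_on_Qcent`). Functionals on `Q_cent` extend to `𝔖*` by Hahn–Banach, whence
surjectivity. The duality map is isometric because `‖F‖` is already detected by the functionals `F ↦
⟪η, (S_F ⊗ id)(a) ξ⟫` with `a`, `η`, `ξ` in unit balls, and these lie in the unit ball of `Q_cent`
(`norm_le_of_forall_vectorBall`).

It remains to write each element of `Q_cent` as one such vector functional. As `ℓ²` contains
countably many mutually orthogonal copies of itself, vector functionals can be merged by forming
block diagonal operators. Merging two of them shows that `vectorBall` is convex, so Hahn–Banach
separation and the duality make it dense in the unit ball of `Q_cent` (`mem_closure_vectorBall`).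
Successive approximation then expands an element into a geometrically convergent series of vector
functionals, and merging infinitely many blocks collapses the series into a single one
(`exists_vectorOmega_hasSum`, `exists_eq_vectorOmega`). -/

namespace HerzSchur

/-! ### Generators of the crossed product as common eigenvectors. -/

section Generators

lemma norm_le_of_forall_apply_le {Z : Type*} [TopologicalSpace Z] {a : C₀(Z, ℂ)} {C : ℝ}
    (hC : 0 ≤ C) (h : ∀ z, ‖a z‖ ≤ C) : ‖a‖ ≤ C := by
  rw [← ZeroAtInftyContinuousMap.norm_toBCF_eq_norm, BoundedContinuousFunction.norm_le hC]
  exact h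

variable {Z G H : Type*} [TopologicalSpace Z] [DiscreteTopology Z] [Group G]
  [NormedAddCommGroup H] [InnerProductSpace ℂ H] [CompleteSpace H]

lemma delta_apply_self (z : Z) : delta z z = 1 := Set.indicator_of_mem (Set.mem_singleton z) _

lemma delta_apply_of_ne {z w : Z} (h : w ≠ z) : delta z w = 0 :=
  Set.indicator_of_notMem (s := {z}) (f := (1 : Z → ℂ)) h

lemma sum_smul_delta_apply (T : Finset Z) (c : Z → ℂ) (w : Z) [Decidable (w ∈ T)] :
    (∑ z ∈ T, c z • delta z) w = if w ∈ T then c w else 0 := by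
  classical
  have : ∀ S : Finset Z, (∑ z ∈ S, c z • delta z) w = ∑ z ∈ S, c z * delta z w := by
    intro S
    induction S using Finset.induction_on with
    | empty => simp
    | insert z S hz ih => simp [Finset.sum_insert hz, ih]
  rw [this]
  split_ifs with h
  · rw [Finset.sum_eq_single_of_mem w h fun z _ hz => by rw [delta_apply_of_ne hz.symm, mul_zero],
      delta_apply_self, mul_one]
  · exact Finset.sum_eq_zero fun z hz => by
      rw [delta_apply_of_ne (by rintro rfl; exact h hz), mul_zero]

/-- A function in `C₀(Z)` is the norm limit of its restrictions to finite sets. -/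
lemma hasSum_delta (a : C₀(Z, ℂ)) : HasSum (fun z => a z • delta z) a := by
  classical
  rw [HasSum, SummationFilter.unconditional_filter, Metric.tendsto_atTop]
  intro ε hε
  have h0 : ∀ᶠ z in Filter.cofinite, ‖a z‖ < ε / 2 := by
    have := (zero_at_infty a).norm
    rw [Filter.cocompact_eq_cofinite, norm_zero] at this
    exact this.eventually_lt_const (half_pos hε)
  have hfin : {z | ¬ ‖a z‖ < ε / 2}.Finite := h0
  refine ⟨hfin.toFinset, fun T hT => ?_⟩
  rw [dist_eq_norm]
  refine lt_of_le_of_lt (norm_le_of_forall_apply_le (half_pos hε).le fun w => ?_) (half_lt_self hε)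
  rw [ZeroAtInftyContinuousMap.coe_sub, Pi.sub_apply, sum_smul_delta_apply]
  split_ifs with h
  · simpa using (half_pos hε).le
  · rw [zero_sub, norm_neg]
    by_contra hw
    exact h (hT (hfin.mem_toFinset.2 fun h' => hw h'.le))

/-- A left centralizer of `C₀(Z)` acts by pointwise multiplication. -/
lemma centralizer_fst_apply (m : 𝓜(ℂ, C₀(Z, ℂ))) (a : C₀(Z, ℂ)) (z : Z) :
    m.fst a z = m.fst (delta z) z * a z := by
  -- Evaluate the centralizer identity `R(δ_z) b = δ_z L(b)` at `z`: the value of `L(b)` at `z`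
  -- depends on `b` only through `b(z)`.
  have h : ∀ b : C₀(Z, ℂ), m.fst b z = m.snd (delta z) z * b z := fun b => by
    have := DFunLike.congr_fun (m.central (delta z) b) z
    simpa [delta_apply_self] using this.symm
  rw [h a, h (delta z), delta_apply_self, mul_one]

lemma centralizer_snd_apply (m : 𝓜(ℂ, C₀(Z, ℂ))) (a : C₀(Z, ℂ)) (z : Z) :
    m.snd a z = m.fst (delta z) z * a z := by
  have := DFunLike.congr_fun (m.central a (delta z)) z
  simp only [ZeroAtInftyContinuousMap.mul_apply, delta_apply_self, mul_one] at this
  rw [this, mul_comm]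

variable (D : CStarSystem C₀(Z, ℂ) G H)

namespace CStarSystem

/-- The elements `π(a) λ_s` of the reduced crossed product. -/
def coeff {A : Type*} [NonUnitalCStarAlgebra A] (D : CStarSystem A G H) (s : G) :
    A →L[ℂ] D.crossedProduct :=
  letI := Classical.decEq G
  LinearMap.mkContinuous
    { toFun := fun a => D.toCrossedProduct ⟨Pi.single s a, single_mem_ell1 s a⟩
      map_add' := fun a b => by
        rw [← map_add]
        exact congrArg _ (Subtype.ext (Pi.single_add (f := fun _ : G => A) s a b))
      map_smul' := fun c a => by
        rw [← map_smul]
        exact congrArg _ (Subtype.ext (Pi.single_smul (f := fun _ : G => A) s c a)) }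
    1 fun a => by
      rw [one_mul]
      exact ((congrArg norm (D.integrated_single s a)).trans (D.norm_reprA_mul a s)).le

lemma coeff_val {A : Type*} [NonUnitalCStarAlgebra A] (D : CStarSystem A G H) (s : G) (a : A) :
    (D.coeff s a : L2 G H →L[ℂ] L2 G H) = D.reprA a * reprG H s :=
  @integrated_single A G H _ _ _ _ _ D (Classical.decEq G) s a

lemma hasSum_coeff {A : Type*} [NonUnitalCStarAlgebra A] (D : CStarSystem A G H)
    (f : ell1 G A) : HasSum (fun s => D.coeff s ((f : G → A) s)) (D.toCrossedProduct f) := by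
  have h := (D.summable_integrated f.2).hasSum
  refine (Topology.IsInducing.hasSum_iff (g := D.crossedProduct.subtype) ⟨rfl⟩ _ _).1 ?_
  convert h using 1
  · exact funext fun s => D.coeff_val s _
  · rfl

/-- A closed subspace containing the elements `π(δ_z) λ_s` is everything. -/
lemma mem_of_coeff_delta_mem (S : Submodule ℂ D.crossedProduct)
    (hS : IsClosed (S : Set D.crossedProduct)) (h : ∀ s z, D.coeff s (delta z) ∈ S)
    (T : D.crossedProduct) : T ∈ S := by
  have hd : DenseRange D.toCrossedProduct := by
    have hd : DenseRange fun t : LinearMap.range D.integratedₗ =>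
        (⟨t, Submodule.le_topologicalClosure _ t.2⟩ : D.crossedProduct) :=
      (denseRange_inclusion_iff subset_closure).2 subset_rfl
    refine hd.mono ?_
    rintro _ ⟨⟨_, f, rfl⟩, rfl⟩
    exact ⟨f, rfl⟩
  -- Two nested norm convergent expansions: `f ∈ ℓ¹` splits over `s ∈ G`, then each coefficient
  -- `f(s)` splits over `z ∈ Z`.
  refine hd.induction_on T hS fun f => hS.mem_of_tendsto (D.hasSum_coeff f)
    (Filter.Eventually.of_forall fun t => S.sum_mem fun s _ => ?_)
  refine hS.mem_of_tendsto ((hasSum_delta ((f : G → C₀(Z, ℂ)) s)).mapL (D.coeff s))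
    (Filter.Eventually.of_forall fun t => S.sum_mem fun z _ => ?_)
  rw [map_smul]
  exact S.smul_mem _ (h s z)

namespace CentralMultiplier

variable {D}

lemma S_coeff {A : Type*} [NonUnitalCStarAlgebra A] {D : CStarSystem A G H}
    (F : D.CentralMultiplier) (s : G) (a : A) :
    F.S (D.coeff s a) = D.coeff s (F.toFun s a) := by
  classical
  refine Subtype.ext ((F.implements_S _).trans ?_)
  rw [coeff_val, ← D.integrated_single]
  congr 1
  ext r
  rcases eq_or_ne r s with rfl | h
  · simp
  · simp [h]

/-- Centrality enters here: `F(s)` is one half of a double centralizer of `C₀(Z)`, so it acts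
pointwise and preserves the line through `δ_z`. -/
lemma toFun_delta (F : D.CentralMultiplier) (s : G) (z : Z) :
    F.toFun s (delta z) = evalAt D (z, s) F • delta z := by
  obtain ⟨m, -, hm⟩ := F.2.2 s
  have hm' : F.toFun s = m.fst := hm
  ext w
  change F.toFun s (delta z) w = F.toFun s (delta z) z * delta z w
  rw [hm', centralizer_fst_apply m (delta z) w]
  rcases eq_or_ne w z with rfl | h
  · rfl
  · simp [delta_apply_of_ne h]

/-- This joint diagonalisation links functionals built from `S_F` to the point evaluations that span
`C_c(Z × G)`. Both inclusions and the duality rest on it. -/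
lemma S_coeff_delta (F : D.CentralMultiplier) (s : G) (z : Z) :
    F.S (D.coeff s (delta z)) = evalAt D (z, s) F • D.coeff s (delta z) := by
  rw [S_coeff, toFun_delta, map_smul]

end CentralMultiplier

end CStarSystem

end Generators

/-! ### Elementary tensors and normality of vector functionals. -/

section TensorOperators

variable {K : Type*} [NormedAddCommGroup K] [InnerProductSpace ℂ K]

lemma norm_tensorOp_le (T : K →L[ℂ] K) (b : SeqL2 →L[ℂ] SeqL2) :
    ‖tensorOp T b‖ ≤ ‖T‖ * ‖b‖ := by
  refine ContinuousLinearMap.opNorm_le_bound _ (by positivity) fun v => ?_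
  refine denseRange_toTensorL2.induction_on v (isClosed_le (by fun_prop) (by fun_prop)) fun t => ?_
  have h1 : tensorOp T b (toTensorL2 t) = toTensorL2 (TensorProduct.mapL T b t) :=
    (TensorProduct.mapL T b).completion_apply_coe t
  have h2 : ∀ u : K ⊗[ℂ] SeqL2, ‖toTensorL2 u‖ = ‖u‖ := fun u => UniformSpace.Completion.norm_coe u
  rw [h1, h2, h2]
  exact ContinuousLinearMap.le_of_opNorm_le _ (TensorProduct.norm_mapL_le T b) t

variable {E : Submodule ℂ (K →L[ℂ] K)}

/-- The elementary tensor `T ⊗ b`, as a continuous map of `T`. -/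
def tmulMin (E : Submodule ℂ (K →L[ℂ] K)) (b : CompactL2) : E →L[ℂ] MinTensor E :=
  LinearMap.mkContinuous
    (toMinTensor E ∘ₗ (TensorProduct.mk ℂ E CompactL2).flip b : E →ₗ[ℂ] MinTensor E)
    ‖(b : SeqL2 →L[ℂ] SeqL2)‖ fun T => by
      rw [mul_comm]
      exact norm_tensorOp_le (T : K →L[ℂ] K) (b : SeqL2 →L[ℂ] SeqL2)

/-- A closed subspace of `E ⊗ K(ℓ²)` containing all elementary tensors is everything. -/
lemma mem_of_tmulMin_mem (S : Submodule ℂ (MinTensor E)) (hS : IsClosed (S : Set (MinTensor E)))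
    (h : ∀ b T, tmulMin E b T ∈ S) (a : MinTensor E) : a ∈ S := by
  refine (denseRange_toMinTensor E).induction_on a hS fun t => ?_
  induction t using AlgTensor.induction with
  | zero => rw [map_zero]; exact zero_mem _
  | tmul T b => exact h b T
  | add t t' ht ht' => rw [map_add]; exact add_mem ht ht'

lemma amplify_tmulMin {Φ : E →ₗ[ℂ] E} (hΦ : IsCB E.subtype Φ) (b : CompactL2) (T : E) :
    amplify Φ (tmulMin E b T) = tmulMin E b (Φ T) :=
  hΦ.bound.amplify_apply _

/-- The vector functional `T ↦ ⟪η, T ξ⟫`. -/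
def vectorFunctional (N : Subalgebra ℂ (K →L[ℂ] K)) (η ξ : K) : N →L[ℂ] ℂ :=
  LinearMap.mkContinuous
    { toFun := fun T => ⟪η, (T : K →L[ℂ] K) ξ⟫_ℂ
      map_add' := fun T S => by simp
      map_smul' := fun c T => by simp }
    (‖η‖ * ‖ξ‖) fun T => by
      refine (norm_inner_le_norm _ _).trans ?_
      rw [mul_assoc, mul_comm ‖ξ‖]
      exact mul_le_mul_of_nonneg_left ((T : K →L[ℂ] K).le_opNorm ξ) (norm_nonneg _)

lemma isNormal_vectorFunctional (N : Subalgebra ℂ (K →L[ℂ] K)) (η ξ : K) :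
    IsNormal (vectorFunctional N η ξ) := by
  -- Sequences concentrated at index `0` exhibit a vector functional as a member of the family
  -- defining the ultraweak topology.
  have h : @Continuous (K →L[ℂ] K) ℂ (ultraweakTopology K) inferInstance
      fun T => ∑' n, ⟪L2.coord n (L2.single 0 η : L2 ℕ K), T (L2.coord n (L2.single 0 ξ))⟫_ℂ :=
    continuous_iInf_dom (i := (L2.single 0 η, L2.single 0 ξ)) continuous_induced_dom
  have h' : (fun T : K →L[ℂ] K => ∑' n, ⟪L2.coord n (L2.single 0 η : L2 ℕ K),
      T (L2.coord n (L2.single 0 ξ))⟫_ℂ) = fun T => ⟪η, T ξ⟫_ℂ := by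
    funext T
    rw [tsum_eq_single 0 fun n hn => by simp [L2.coord_single, hn]]
    simp [L2.coord_single]
  rw [h'] at h
  let := ultraweakTopology K
  exact h.comp continuous_induced_dom

end TensorOperators

/-! ### Finite matrices inside `E ⊗ K(ℓ²)`. -/

section MatrixUnits

variable {K : Type*} [NormedAddCommGroup K] [InnerProductSpace ℂ K]

/-- The rank one operator `y ↦ y_j e_i` on `ℓ²`. -/
def matrixUnit (i j : ℕ) : CompactL2 :=
  ⟨(ContinuousLinearMap.toSpanSingleton ℂ (basisL2 i)) ∘L L2.coord j,
    show IsCompactOperator ((ContinuousLinearMap.toSpanSingleton ℂ (basisL2 i)) ∘ L2.coord j) from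
      (isCompactOperator_of_locallyCompactSpace_rng
        (ContinuousLinearMap.toSpanSingleton ℂ (basisL2 i))).comp_clm _⟩

lemma matrixUnit_apply (i j : ℕ) (y : SeqL2) :
    (matrixUnit i j : SeqL2 →L[ℂ] SeqL2) y = L2.coord j y • basisL2 i := rfl

lemma L2.inner_single {I : Type*} (i : I) (k : K) (ξ : L2 I K) :
    ⟪L2.single i k, ξ⟫_ℂ = ⟪k, L2.coord i ξ⟫_ℂ := by
  classical
  refine (L2.hasSum_inner _ ξ).unique ?_
  convert hasSum_ite_eq i ⟪k, L2.coord i ξ⟫_ℂ using 2 with i'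
  rw [L2.coord_single]
  split_ifs with h
  · rw [h]
  · simp

/-- The isometry `inclFin` as a continuous linear map. -/
def inclFinL (n : ℕ) : L2 (Fin n) K →L[ℂ] TensorL2 K :=
  LinearMap.mkContinuous
    { toFun := inclFin n
      map_add' := fun ξ η => by simp [inclFin, tmulL2_add, Finset.sum_add_distrib]
      map_smul' := fun c ξ => by simp [inclFin, tmulL2_smul, Finset.smul_sum] }
    1 fun ξ => (norm_inclFin ξ).le.trans_eq (one_mul _).symm

lemma inclFinL_apply {n : ℕ} (ξ : L2 (Fin n) K) : inclFinL n ξ = inclFin n ξ := rfl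

lemma norm_inclFinL_le (n : ℕ) : ‖inclFinL (K := K) n‖ ≤ 1 :=
  LinearMap.mkContinuous_norm_le _ zero_le_one _

/-- The adjoint of the isometry truncates the second leg to its first `n` coordinates. -/
lemma coord_adjoint_inclFinL [CompleteSpace K] {n : ℕ} (x : K) (y : SeqL2) (i : Fin n) :
    L2.coord i (ContinuousLinearMap.adjoint (inclFinL n) (tmulL2 x y)) = L2.coord (i : ℕ) y • x := by
  refine ext_inner_left ℂ fun k => ?_
  rw [← L2.inner_single, ContinuousLinearMap.adjoint_inner_right, inclFinL_apply, inclFin,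
    Finset.sum_eq_single i (fun j _ hj => by simp [L2.coord_single, hj, tmulL2_apply]) (by simp),
    L2.coord_single, if_pos rfl, inner_tmulL2, inner_basisL2, inner_smul_right, mul_comm]

/-- The element `∑ x_{ij} ⊗ e_{ij}` of `E ⊙ K(ℓ²)`. -/
def ofMatrix {E : Submodule ℂ (K →L[ℂ] K)} {n : ℕ} (x : Matrix (Fin n) (Fin n) E) : AlgTensor E :=
  ∑ i, ∑ j, AlgTensor.tmul (x i j) (matrixUnit i j)

/-- With `V` the isometry `inclFinL n`, a finite matrix sits in `B(K ⊗ ℓ²)` as `V x V*`, so the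
embedding does not increase its norm. This is the counterpart of `norm_corner_le`. -/
lemma algTensor_ofMatrix [CompleteSpace K] {E : Submodule ℂ (K →L[ℂ] K)} {n : ℕ}
    (x : Matrix (Fin n) (Fin n) E) :
    algTensor E (ofMatrix x) = inclFinL n ∘L blockOp (x.map fun v => E.subtype v) ∘L
      ContinuousLinearMap.adjoint (inclFinL n) := by
  refine tensorOp_ext fun u y => ?_
  simp only [ofMatrix, map_sum, algTensor_tmul, sum_apply, tensorOp_tmulL2,
    ContinuousLinearMap.comp_apply, inclFinL_apply, inclFin, blockOp_apply, coord_adjoint_inclFinL,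
    matrixUnit_apply, map_smul]
  refine Finset.sum_congr rfl fun i _ => ?_
  simp only [tmulL2_apply, TensorProduct.sum_tmul, map_sum, Matrix.map_apply,
    Submodule.subtype_apply, ← TensorProduct.smul_tmul', map_smul]

lemma norm_algTensor_ofMatrix_le [CompleteSpace K] {E : Submodule ℂ (K →L[ℂ] K)} {n : ℕ}
    (x : Matrix (Fin n) (Fin n) E) :
    ‖algTensor E (ofMatrix x)‖ ≤ ‖blockOp (x.map fun v => E.subtype v)‖ := by
  have h : ‖ContinuousLinearMap.adjoint (inclFinL (K := K) n)‖ ≤ 1 := by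
    rw [LinearIsometryEquiv.norm_map]
    exact norm_inclFinL_le n
  rw [algTensor_ofMatrix]
  refine (ContinuousLinearMap.opNorm_comp_le _ _).trans ?_
  refine (mul_le_mul (norm_inclFinL_le n) ((ContinuousLinearMap.opNorm_comp_le _ _).trans
    (mul_le_of_le_one_right (norm_nonneg _) h)) (norm_nonneg _) zero_le_one).trans_eq (one_mul _)

lemma corner_ofMatrix {E : Submodule ℂ (K →L[ℂ] K)} {n : ℕ} (x : Matrix (Fin n) (Fin n) E) :
    corner E n (ofMatrix x) = x := by
  ext i j : 2
  simp only [corner, Matrix.of_apply, ofMatrix, map_sum, slice_tmul, matrixUnit_apply, basisL2,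
    map_smul, L2.coord_single, Fin.val_inj]
  rw [Finset.sum_eq_single i (fun k _ hk => by simp [hk.symm]) (by simp),
    Finset.sum_eq_single j (fun k _ hk => by simp [hk]) (by simp)]
  simp

/-- Complete boundedness is detected by the amplification to `E ⊗ K(ℓ²)`. -/
lemma cbBound_of_norm_inner_amplify_le [CompleteSpace K] {E : Submodule ℂ (K →L[ℂ] K)}
    {Φ : E →ₗ[ℂ] E}
    (hΦ : IsCB E.subtype Φ) {M : ℝ} (hM : 0 ≤ M)
    (h : ∀ a η ξ, ‖⟪η, (amplify Φ a).val ξ⟫_ℂ‖ ≤ M * ‖a‖ * ‖η‖ * ‖ξ‖) :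
    CBBound E.subtype Φ M := by
  refine ⟨hM, fun n x => ?_⟩
  -- The matrix `x` is a corner of its own image `∑ x_{ij} ⊗ e_{ij}`, and taking corners commutes
  -- with `Φ`. Hence the norm of `Φ_n(x)` is at most that of `Φ ⊗ id` at this image.
  have hcorner : (x.map fun v => E.subtype (Φ v)) =
      (corner E n (AlgTensor.map Φ (ofMatrix x))).map fun v => E.subtype v := by
    conv_lhs => rw [← corner_ofMatrix x]
    ext i j : 2
    simp [corner, slice_map]
  rw [hcorner]
  refine (norm_corner_le E _ n).trans
    (le_trans ?_ (mul_le_mul_of_nonneg_left (norm_algTensor_ofMatrix_le x) hM))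
  rw [← val_toMinTensor, ← hΦ.bound.amplify_apply]
  refine ContinuousLinearMap.opNorm_le_of_re_inner_le (𝕜 := ℂ) (by positivity)
    fun ξ η hξ hη => (RCLike.re_le_norm _).trans ?_
  rw [norm_inner_symm]
  refine (h (toMinTensor E (ofMatrix x)) η ξ).trans_eq ?_
  rw [hξ, hη, mul_one, mul_one, norm_toMinTensor]

end MatrixUnits

/-! ### The functionals `ω_{a,f}` lie in `Q_cent`. -/

section Functionals

/-- The von Neumann algebra `(A ⋊_r G)'' ⊗̄ B(ℓ²)`. -/
abbrev vnAlg {A G H : Type*} [NonUnitalCStarAlgebra A] [Group G]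
    [NormedAddCommGroup H] [InnerProductSpace ℂ H] [CompleteSpace H] (D : CStarSystem A G H) :
    Subalgebra ℂ (TensorL2 (L2 G H) →L[ℂ] TensorL2 (L2 G H)) :=
  vnTensor (bicommutant (D.crossedProduct : Set (L2 G H →L[ℂ] L2 G H)))

lemma norm_omega_apply_le {A G H : Type*} [NonUnitalCStarAlgebra A] [Group G]
    [NormedAddCommGroup H] [InnerProductSpace ℂ H] [CompleteSpace H] {D : CStarSystem A G H}
    (a : MinTensor D.crossedProduct)
    (f : vnAlg D →L[ℂ] ℂ)
    (F : D.CentralMultiplier) : ‖D.omega a f F‖ ≤ ‖f‖ * ‖a‖ * ‖F‖ := by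
  refine (f.le_opNorm _).trans ?_
  rw [MinTensor.norm_toVN, mul_assoc, mul_comm ‖a‖]
  exact mul_le_mul_of_nonneg_left (F.isCB_S.bound.norm_amplify_le a) (norm_nonneg _)

/-- `ω_{a,f}` as a continuous linear map of `a`. -/
def omegaL {A G H : Type*} [NonUnitalCStarAlgebra A] [Group G]
    [NormedAddCommGroup H] [InnerProductSpace ℂ H] [CompleteSpace H] (D : CStarSystem A G H)
    (f : vnAlg D →L[ℂ] ℂ) :
    MinTensor D.crossedProduct →L[ℂ] StrongDual ℂ D.CentralMultiplier :=
  LinearMap.mkContinuous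
    { toFun := fun a => D.omega a f
      map_add' := fun a b => by
        ext F
        change f (amplify F.S (a + b)).toVN = f (amplify F.S a).toVN + f (amplify F.S b).toVN
        rw [map_add, MinTensor.toVN_add, map_add]
      map_smul' := fun c a => by
        ext F
        change f (amplify F.S (c • a)).toVN = c • f (amplify F.S a).toVN
        rw [map_smul, MinTensor.toVN_smul, map_smul] }
    ‖f‖ fun a =>
      ContinuousLinearMap.opNorm_le_bound _ (by positivity) (norm_omega_apply_le a f)

variable {Z G H : Type*} [TopologicalSpace Z] [DiscreteTopology Z] [Group G]
  [NormedAddCommGroup H] [InnerProductSpace ℂ H] [CompleteSpace H]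
  (D : CStarSystem C₀(Z, ℂ) G H)

/-- The functionals `ω_{a,f}` belong to `Q_cent`. -/
lemma omega_mem (a : MinTensor D.crossedProduct) (f : vnAlg D →L[ℂ] ℂ) :
    D.omega a f ∈ (LinearMap.range (pairing D)).topologicalClosure := by
  have hQ := Submodule.isClosed_topologicalClosure (LinearMap.range (pairing D))
  let S := (LinearMap.range (pairing D)).topologicalClosure.comap (omegaL D f).toLinearMap
  have hS : IsClosed (S : Set (MinTensor D.crossedProduct)) := hQ.preimage (omegaL D f).continuous
  -- The preimage of `Q_cent` under `a ↦ ω_{a,f}` is closed, so totality of the elementary tensors,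
  -- and then of the generators in the first leg, reduces the claim to `a = π(δ_z)λ_s ⊗ b`.
  suffices h : ∀ b T, tmulMin D.crossedProduct b T ∈ S from mem_of_tmulMin_mem S hS h a
  intro b T
  suffices h : ∀ s z, D.coeff s (delta z) ∈ S.comap (tmulMin D.crossedProduct b).toLinearMap from
    D.mem_of_coeff_delta_mem _ (hS.preimage (tmulMin D.crossedProduct b).continuous) h T
  intro s z
  -- Here `S_F ⊗ id` multiplies `a` by `φ(z,s)`, so `ω_{a,f}` is the point evaluation at `(z,s)`
  -- with coefficient `f(a)`.
  refine Submodule.le_topologicalClosure _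
    ⟨Finsupp.single (z, s) (f (tmulMin D.crossedProduct b (D.coeff s (delta z))).toVN), ?_⟩
  ext F
  have h : D.omega (tmulMin D.crossedProduct b (D.coeff s (delta z))) f F =
      f (amplify F.S (tmulMin D.crossedProduct b (D.coeff s (delta z)))).toVN := rfl
  change _ = D.omega (tmulMin D.crossedProduct b (D.coeff s (delta z))) f F
  rw [h, amplify_tmulMin F.isCB_S, F.S_coeff_delta, map_smul, MinTensor.toVN_smul, map_smul,
    pairing, Finsupp.linearCombination_single, smul_apply, smul_eq_mul, smul_eq_mul, mul_comm]

end Functionals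

/-! ### Bounded functions on `Z` as central, completely bounded multiplications. -/

section MultiplicationOperators

variable {Z : Type*} [TopologicalSpace Z] [DiscreteTopology Z]

/-- The multiplication by a bounded function on `C₀(Z)`, for discrete `Z`. -/
def mulOp (φ : Z → ℂ) (C : ℝ) (hφ : ∀ z, ‖φ z‖ ≤ C) : C₀(Z, ℂ) →L[ℂ] C₀(Z, ℂ) :=
  LinearMap.mkContinuous
    { toFun := fun a =>
        { toFun := fun z => φ z * a z
          continuous_toFun := continuous_of_discreteTopology
          zero_at_infty' := by
            refine squeeze_zero_norm (fun z => (norm_mul_le _ _).trans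
              (mul_le_mul_of_nonneg_right (hφ z) (norm_nonneg _))) ?_
            simpa using (zero_at_infty a).norm.const_mul C }
      map_add' := fun a b => by ext z; exact mul_add _ _ _
      map_smul' := fun c a => by ext z; exact mul_left_comm _ _ _ }
    -- The bound `C` can be negative when `Z` is empty, hence the maximum.
    (max C 0) fun a => norm_le_of_forall_apply_le (by positivity) fun z => (norm_mul_le _ _).trans
      (mul_le_mul ((hφ z).trans (le_max_left _ _)) (norm_apply_le_norm a z) (norm_nonneg _)
        (le_max_right _ _))

lemma mulOp_apply (φ : Z → ℂ) (C : ℝ) (hφ : ∀ z, ‖φ z‖ ≤ C) (a : C₀(Z, ℂ)) (z : Z) :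
    mulOp φ C hφ a z = φ z * a z := rfl

lemma mulOp_delta (φ : Z → ℂ) (C : ℝ) (hφ : ∀ z, ‖φ z‖ ≤ C) (z : Z) :
    mulOp φ C hφ (delta z) = φ z • delta z := by
  ext w
  rw [mulOp_apply]
  rcases eq_or_ne w z with rfl | h
  · rfl
  · simp [delta_apply_of_ne h]

/-- Multiplication by `φ` serves as both halves of the centralizer because `C₀(Z)` is commutative.
It is central because every other centralizer also acts by pointwise multiplication. -/
lemma exists_mem_center_fst_eq_mulOp (φ : Z → ℂ) (C : ℝ) (hφ : ∀ z, ‖φ z‖ ≤ C) :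
    ∃ m ∈ Subalgebra.center ℂ 𝓜(ℂ, C₀(Z, ℂ)), mulOp φ C hφ = m.fst := by
  refine ⟨⟨(mulOp φ C hφ, mulOp φ C hφ), fun a b => ?_⟩, ?_, rfl⟩
  · ext z
    simp only [ZeroAtInftyContinuousMap.mul_apply, mulOp_apply]
    ring
  · rw [Subalgebra.mem_center_iff]
    intro b
    refine DoubleCentralizer.ext _ _ _ _ (Prod.ext ?_ ?_)
    · ext a z
      change b.fst (mulOp φ C hφ a) z = φ z * b.fst a z
      rw [centralizer_fst_apply b, centralizer_fst_apply b a, mulOp_apply]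
      ring
    · ext a z
      change φ z * b.snd a z = b.snd (mulOp φ C hφ a) z
      rw [centralizer_snd_apply b a, centralizer_snd_apply b (mulOp φ C hφ a), mulOp_apply]
      ring

/-- In general `φ` is not in `C₀(Z)` and so not in the domain of `D.rep`. Its finite truncations
are, and they converge to it strictly. -/
lemma tendsto_sum_smul_delta_mul (φ : Z → ℂ) (C : ℝ) (hφ : ∀ z, ‖φ z‖ ≤ C) (a : C₀(Z, ℂ)) :
    Filter.Tendsto (fun T : Finset Z => (∑ z ∈ T, φ z • delta z) * a) Filter.atTop
      (𝓝 (mulOp φ C hφ a)) := by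
  classical
  refine (hasSum_delta (mulOp φ C hφ a)).congr fun T => ?_
  ext w
  rw [sum_smul_delta_apply, ZeroAtInftyContinuousMap.mul_apply, sum_smul_delta_apply]
  split_ifs
  · rfl
  · simp

/-- Multiplication operators on `C₀(Z) ⊆ B(H)` are completely bounded. -/
lemma cbBound_mulOp {G H : Type*} [Group G] [NormedAddCommGroup H] [InnerProductSpace ℂ H]
    [CompleteSpace H] (D : CStarSystem C₀(Z, ℂ) G H) (φ : Z → ℂ) (C : ℝ) (hC : 0 ≤ C)
    (hφ : ∀ z, ‖φ z‖ ≤ C) : CBBound D.repₗ (mulOp φ C hφ).toLinearMap C := by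
  classical
  refine ⟨hC, fun n x => ?_⟩
  have hrep : Continuous D.repₗ :=
    (LinearMap.mkContinuous D.repₗ 1 fun a => by
      rw [one_mul]; exact D.norm_rep_le a).continuous
  have hlim : Filter.Tendsto (fun T : Finset Z =>
      blockOp (x.map fun v => D.repₗ ((∑ z ∈ T, φ z • delta z) * v))) Filter.atTop
      (𝓝 (blockOp (x.map fun v => D.repₗ ((mulOp φ C hφ).toLinearMap v)))) := by
    refine tendsto_finsetSum _ fun i _ => tendsto_finsetSum _ fun j _ => ?_
    have h1 := (hrep.tendsto _).comp (tendsto_sum_smul_delta_mul φ C hφ (x i j))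
    have h2 : Continuous fun S : H →L[ℂ] H =>
        (L2.single i : H →L[ℂ] L2 (Fin n) H) ∘L S ∘L L2.coord j := by fun_prop
    exact (h2.tendsto _).comp h1
  refine le_of_tendsto hlim.norm (Filter.Eventually.of_forall fun T => ?_)
  have hT : ‖D.rep (∑ z ∈ T, φ z • delta z)‖ ≤ C := by
    refine (D.norm_rep_le _).trans (norm_le_of_forall_apply_le hC fun z => ?_)
    rw [sum_smul_delta_apply]
    split_ifs
    · exact hφ z
    · simpa using hC
  -- For a truncation, the amplified map is left multiplication by one operator of norm at most `C`,
  -- repeated in each coordinate of `Hⁿ`. The bound is therefore the same for all `n`.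
  have hfac : blockOp (x.map fun v => D.repₗ ((∑ z ∈ T, φ z • delta z) * v)) =
      L2.diagOp (fun _ : Fin n => D.rep (∑ z ∈ T, φ z • delta z)) C (fun _ => hT) ∘L
        blockOp (x.map fun v => D.repₗ v) := by
    ext ξ i
    rw [ContinuousLinearMap.comp_apply, L2.coord_diagOp, blockOp_apply, blockOp_apply, map_sum]
    refine Finset.sum_congr rfl fun j _ => ?_
    change D.rep (_ * x i j) _ = _
    rw [map_mul]
    rfl
  rw [hfac]
  refine (ContinuousLinearMap.opNorm_comp_le _ _).trans
    (mul_le_mul_of_nonneg_right ?_ (norm_nonneg _))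
  exact (LinearMap.mkContinuous_norm_le _ (le_max_right _ _) _).trans_eq (max_eq_left hC)

end MultiplicationOperators

/-! ### From functionals on the dual of the multipliers back to multipliers. -/

section Bidual

lemma inner_blockOp {K : Type*} [NormedAddCommGroup K] [InnerProductSpace ℂ K] {n : ℕ}
    (x : Matrix (Fin n) (Fin n) (K →L[ℂ] K)) (η ξ : L2 (Fin n) K) :
    ⟪η, blockOp x ξ⟫_ℂ = ∑ i, ∑ j, ⟪L2.coord i η, x i j (L2.coord j ξ)⟫_ℂ := by
  rw [(L2.hasSum_inner η _).unique (hasSum_fintype _)]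
  simp only [blockOp_apply, inner_sum]

/-- The functional `F ↦ ⟪η, S_F(T) ξ⟫`. -/
def matrixCoeff {A G H : Type*} [NonUnitalCStarAlgebra A] [Group G] [NormedAddCommGroup H]
    [InnerProductSpace ℂ H] [CompleteSpace H] (D : CStarSystem A G H) (T : D.crossedProduct)
    (η ξ : L2 G H) : StrongDual ℂ D.CentralMultiplier :=
  LinearMap.mkContinuous
    { toFun := fun F => ⟪η, (F.S T : L2 G H →L[ℂ] L2 G H) ξ⟫_ℂ
      map_add' := fun F F' => by
        rw [F.S_add]
        exact inner_add_right _ _ _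
      map_smul' := fun c F => by
        rw [F.S_smul]
        exact inner_smul_right _ _ _ }
    (‖T‖ * ‖η‖ * ‖ξ‖) fun F => by
      calc ‖⟪η, (F.S T : L2 G H →L[ℂ] L2 G H) ξ⟫_ℂ‖
          ≤ ‖η‖ * (‖F.S T‖ * ‖ξ‖) := (norm_inner_le_norm _ _).trans (mul_le_mul_of_nonneg_left
            ((F.S T : L2 G H →L[ℂ] L2 G H).le_opNorm ξ) (norm_nonneg _))
        _ ≤ ‖η‖ * (‖F‖ * ‖T‖ * ‖ξ‖) := by gcongr; exact F.norm_S_le T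
        _ = _ := by ring

section

variable {A G H : Type*} [NonUnitalCStarAlgebra A] [Group G] [NormedAddCommGroup H]
  [InnerProductSpace ℂ H] [CompleteSpace H] (D : CStarSystem A G H)

@[simp] lemma matrixCoeff_apply (T : D.crossedProduct) (η ξ : L2 G H) (F : D.CentralMultiplier) :
    matrixCoeff D T η ξ F = ⟪η, (F.S T : L2 G H →L[ℂ] L2 G H) ξ⟫_ℂ := rfl

lemma norm_matrixCoeff_le (T : D.crossedProduct) (η ξ : L2 G H) :
    ‖matrixCoeff D T η ξ‖ ≤ ‖T‖ * ‖η‖ * ‖ξ‖ :=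
  LinearMap.mkContinuous_norm_le _ (by positivity) _

/-- The sum is the functional `F ↦ ⟪η, (S_F)_n(x) ξ⟫`, which the completely bounded norm of `S_F`
controls uniformly in `n`. Applying `Λ` to it turns boundedness of `Λ` into complete boundedness of
the operator map that `Λ` induces. -/
lemma norm_sum_matrixCoeff_le {n : ℕ} (x : Matrix (Fin n) (Fin n) D.crossedProduct)
    (η ξ : L2 (Fin n) (L2 G H)) :
    ‖∑ i, ∑ j, matrixCoeff D (x i j) (L2.coord i η) (L2.coord j ξ)‖ ≤
      ‖blockOp (x.map fun v => D.crossedProduct.subtype v)‖ * ‖η‖ * ‖ξ‖ := by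
  refine ContinuousLinearMap.opNorm_le_bound _ (by positivity) fun F => ?_
  have h : (∑ i, ∑ j, matrixCoeff D (x i j) (L2.coord i η) (L2.coord j ξ)) F =
      ⟪η, blockOp (x.map fun v => D.crossedProduct.subtype (F.S v)) ξ⟫_ℂ := by
    simp [inner_blockOp, sum_apply]
  rw [h]
  calc ‖⟪η, blockOp (x.map fun v => D.crossedProduct.subtype (F.S v)) ξ⟫_ℂ‖
      ≤ ‖η‖ * (‖blockOp (x.map fun v => D.crossedProduct.subtype (F.S v))‖ * ‖ξ‖) :=
        (norm_inner_le_norm _ _).trans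
          (mul_le_mul_of_nonneg_left (ContinuousLinearMap.le_opNorm _ ξ) (norm_nonneg _))
    _ ≤ ‖η‖ * (‖F‖ * ‖blockOp (x.map fun v => D.crossedProduct.subtype v)‖ * ‖ξ‖) := by
        gcongr; exact F.isCB_S.bound.2 n x
    _ = _ := by ring

/-- For a functional `Λ` on the dual of the central multipliers, the bounded operator `Φ(T)` with
`⟪η, Φ(T) ξ⟫ = Λ(F ↦ ⟪η, S_F(T) ξ⟫)`. -/
lemma exists_operator_of_bidual (Λ : StrongDual ℂ (StrongDual ℂ D.CentralMultiplier)) :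
    ∃ Φ : D.crossedProduct →L[ℂ] (L2 G H →L[ℂ] L2 G H), ∀ T η ξ,
      ⟪η, Φ T ξ⟫_ℂ = Λ (matrixCoeff D T η ξ) := by
  have hbound : ∀ T η ξ, ‖Λ (matrixCoeff D T η ξ)‖ ≤ ‖Λ‖ * ‖T‖ * ‖η‖ * ‖ξ‖ := fun T η ξ => by
    refine (Λ.le_opNorm _).trans ((mul_le_mul_of_nonneg_left (norm_matrixCoeff_le D T η ξ)
      (norm_nonneg _)).trans_eq (by ring))
  have hex : ∀ T : D.crossedProduct, ∃ S : L2 G H →L[ℂ] L2 G H,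
      ∀ η ξ, ⟪η, S ξ⟫_ℂ = Λ (matrixCoeff D T η ξ) := fun T => by
    let B : L2 G H →ₗ⋆[ℂ] L2 G H →ₗ[ℂ] ℂ := LinearMap.mk₂'ₛₗ _ _
      (fun η ξ => Λ (matrixCoeff D T η ξ))
      (fun η η' ξ => by
        rw [← map_add]; congr 1; ext F; simp)
      (fun c η ξ => by
        rw [← map_smul]; congr 1; ext F; simp [mul_comm])
      (fun η ξ ξ' => by
        rw [← map_add]; congr 1; ext F; simp)
      (fun c η ξ => by
        rw [← map_smulₛₗ]; congr 1; ext F; simp)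
    -- `continuousLinearMapOfBilin` represents the form by an operator acting on the left argument
    -- of the inner product; the adjoint moves it to the right.
    refine ⟨ContinuousLinearMap.adjoint (InnerProductSpace.continuousLinearMapOfBilin
      (B.mkContinuous₂ (‖Λ‖ * ‖T‖) (hbound T))), fun η ξ => ?_⟩
    rw [ContinuousLinearMap.adjoint_inner_right,
      InnerProductSpace.continuousLinearMapOfBilin_apply]
    rfl
  choose Φ hΦ using hex
  refine ⟨LinearMap.mkContinuous
    { toFun := Φ
      map_add' := fun T T' => ?_
      map_smul' := fun c T => ?_ } ‖Λ‖ fun T => ?_, hΦ⟩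
  · refine ContinuousLinearMap.ext fun ξ => ext_inner_left ℂ fun η => ?_
    rw [add_apply, inner_add_right, hΦ, hΦ, hΦ, ← map_add]
    congr 1; ext F; simp
  · refine ContinuousLinearMap.ext fun ξ => ext_inner_left ℂ fun η => ?_
    rw [smul_apply, inner_smul_right, hΦ, hΦ, RingHom.id_apply, ← smul_eq_mul, ← map_smul]
    congr 1; ext F; simp
  · refine ContinuousLinearMap.opNorm_le_of_re_inner_le (𝕜 := ℂ) (by positivity)
      fun ξ η hξ hη => (RCLike.re_le_norm _).trans ?_
    rw [norm_inner_symm]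
    change ‖⟪η, Φ T ξ⟫_ℂ‖ ≤ _
    rw [hΦ]
    simpa [hξ, hη] using hbound T η ξ

end

variable {Z G H : Type*} [TopologicalSpace Z] [DiscreteTopology Z] [Group G]
  [NormedAddCommGroup H] [InnerProductSpace ℂ H] [CompleteSpace H]
  (D : CStarSystem C₀(Z, ℂ) G H)

lemma norm_evalAt_le (p : Z × G) : ‖evalAt D p‖ ≤ 1 :=
  LinearMap.mkContinuous_norm_le _ zero_le_one _

/-- Every functional on the dual of the central multipliers coincides on the functionals
`φ ↦ φ(z, s)` with the evaluation at a central multiplier. -/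
lemma exists_multiplier_of_bidual (Λ : StrongDual ℂ (StrongDual ℂ D.CentralMultiplier)) :
    ∃ F : D.CentralMultiplier, ∀ p, evalAt D p F = Λ (evalAt D p) := by
  obtain ⟨Φ, hΦ⟩ := exists_operator_of_bidual D Λ
  have hφ : ∀ s z, ‖Λ (evalAt D (z, s))‖ ≤ ‖Λ‖ := fun s z =>
    (Λ.le_opNorm _).trans (mul_le_of_le_one_right (norm_nonneg _) (norm_evalAt_le D _))
  let F₀ : G → C₀(Z, ℂ) →L[ℂ] C₀(Z, ℂ) := fun s =>
    mulOp (fun z => Λ (evalAt D (z, s))) ‖Λ‖ (hφ s)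
  -- On a generator every matrix coefficient is a multiple of the evaluation at `(z,s)`, so `Λ` of
  -- that evaluation becomes the eigenvalue of `Φ`.
  have hcoeff : ∀ s z, Φ (D.coeff s (delta z)) =
      Λ (evalAt D (z, s)) • (D.coeff s (delta z) : L2 G H →L[ℂ] L2 G H) := fun s z => by
    refine ContinuousLinearMap.ext fun ξ => ext_inner_left ℂ fun η => ?_
    have h : matrixCoeff D (D.coeff s (delta z)) η ξ =
        ⟪η, (D.coeff s (delta z) : L2 G H →L[ℂ] L2 G H) ξ⟫_ℂ • evalAt D (z, s) := by
      ext F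
      rw [matrixCoeff_apply, F.S_coeff_delta, Submodule.coe_smul, smul_apply, inner_smul_right,
        smul_apply, smul_eq_mul, mul_comm]
    rw [hΦ, h, map_smul, smul_apply, inner_smul_right, smul_eq_mul, mul_comm]
  have hF₀ : ∀ s a, Φ (D.coeff s a) = (D.coeff s (F₀ s a) : L2 G H →L[ℂ] L2 G H) := by
    intro s a
    refine ((hasSum_delta a).mapL (Φ ∘L D.coeff s)).unique ?_
    convert (hasSum_delta a).mapL (D.crossedProduct.subtypeL ∘L D.coeff s ∘L F₀ s) using 2 with z
    · rw [map_smul, map_smul]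
      congr 1
      change Φ (D.coeff s (delta z)) = (D.coeff s (F₀ s (delta z)) : L2 G H →L[ℂ] L2 G H)
      rw [hcoeff, mulOp_delta, map_smul, Submodule.coe_smul]
    · rfl
  have hmem : ∀ T, Φ T ∈ D.crossedProduct := fun T => by
    refine D.mem_of_coeff_delta_mem (D.crossedProduct.comap Φ.toLinearMap)
      ((Submodule.isClosed_topologicalClosure _).preimage Φ.continuous) (fun s z => ?_) T
    change Φ (D.coeff s (delta z)) ∈ D.crossedProduct
    rw [hF₀]
    exact Submodule.coe_mem _
  -- The matrix coefficient of `Φ_n(x)` at `η`, `ξ` is `Λ` applied to the functional bounded in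
  -- `norm_sum_matrixCoeff_le`, so `‖Λ‖` works for every `n`.
  have hcb : CBBound D.crossedProduct.subtype (Φ.toLinearMap.codRestrict D.crossedProduct hmem)
      ‖Λ‖ := by
    refine ⟨norm_nonneg Λ, fun n x => ?_⟩
    refine ContinuousLinearMap.opNorm_le_of_re_inner_le (𝕜 := ℂ) (by positivity)
      fun ξ η hξ hη => (RCLike.re_le_norm _).trans ?_
    rw [norm_inner_symm, inner_blockOp]
    have h : ∑ i, ∑ j, ⟪L2.coord i η, (x.map fun v => D.crossedProduct.subtype
        (Φ.toLinearMap.codRestrict D.crossedProduct hmem v)) i j (L2.coord j ξ)⟫_ℂ =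
        Λ (∑ i, ∑ j, matrixCoeff D (x i j) (L2.coord i η) (L2.coord j ξ)) := by
      simp only [map_sum, ← hΦ]
      rfl
    rw [h]
    refine (Λ.le_opNorm _).trans (mul_le_mul_of_nonneg_left ?_ (norm_nonneg _))
    simpa [hξ, hη] using norm_sum_matrixCoeff_le D x η ξ
  have hbd : ∀ r, CBBound D.repₗ (F₀ r).toLinearMap ‖Λ‖ := fun r =>
    cbBound_mulOp D _ _ (norm_nonneg Λ) (hφ r)
  refine ⟨⟨F₀, ⟨⟨_, hbd⟩, _, ⟨_, hcb⟩, fun f => ?_⟩, fun r =>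
    exists_mem_center_fst_eq_mulOp _ _ _⟩, fun p => ?_⟩
  · change Φ (D.toCrossedProduct f) = _
    refine ((D.hasSum_coeff f).mapL Φ).unique ?_
    have h2 := (D.hasSum_coeff ⟨_, CStarSystem.mem_ell1_of_bound hbd f.2⟩).mapL
      D.crossedProduct.subtypeL
    simp only [hF₀]
    exact h2
  · change F₀ p.2 (delta p.1) p.1 = _
    rw [mulOp_apply, delta_apply_self, mul_one]

end Bidual

/-! ### Orthogonal copies of `ℓ²` in itself and block diagonal operators. -/

section Blocks

lemma L2.norm_le_of_coord_eq {I J K : Type*} [NormedAddCommGroup K] [InnerProductSpace ℂ K]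
    {e : I → J} (he : Function.Injective e) {ξ : L2 I K} {η : L2 J K}
    (h : ∀ i, L2.coord i ξ = L2.coord (e i) η) : ‖ξ‖ ≤ ‖η‖ := by
  have h1 : ‖ξ‖ ^ 2 ≤ ‖η‖ ^ 2 :=
    hasSum_le_inj e he (fun _ _ => by positivity) (fun i => by rw [h]) ξ.hasSum_norm_sq
      η.hasSum_norm_sq
  exact le_of_sq_le_sq h1 (norm_nonneg _)

/-- The operator `(R ξ)(i) = ξ (e i)`, for an injective map `e` of the index sets. -/
def L2.compOp {I J K : Type*} [NormedAddCommGroup K] [InnerProductSpace ℂ K] (e : I → J)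
    (he : Function.Injective e) : L2 J K →L[ℂ] L2 I K :=
  LinearMap.mkContinuous
    { toFun := fun ξ => L2.mk (fun i => L2.coord (e i) ξ) <|
        L2.memlp_iff.2 (ξ.hasSum_norm_sq.summable.comp_injective he)
      map_add' := fun ξ η => by ext i; simp
      map_smul' := fun c ξ => by ext i; simp }
    1 fun ξ => by
      rw [one_mul]
      exact L2.norm_le_of_coord_eq he fun _ => rfl

lemma L2.coord_compOp {I J K : Type*} [NormedAddCommGroup K] [InnerProductSpace ℂ K] (e : I → J)
    (he : Function.Injective e) (ξ : L2 J K) (i : I) :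
    L2.coord i (L2.compOp e he ξ) = L2.coord (e i) ξ := rfl

/-- The coisometry of `ℓ²` with `(R_k y)(i) = y(⟨k, i⟩)`, for the pairing `⟨·, ·⟩ : ℕ × ℕ → ℕ`. -/
def blockProj (k : ℕ) : SeqL2 →L[ℂ] SeqL2 :=
  L2.compOp (Nat.pair k) fun _ _ h => (Nat.pair_eq_pair.1 h).2

lemma coord_blockProj (k i : ℕ) (y : SeqL2) :
    L2.coord i (blockProj k y) = L2.coord (Nat.pair k i) y := L2.coord_compOp _ _ _ _

lemma norm_blockProj_le (k : ℕ) : ‖blockProj k‖ ≤ 1 :=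
  ContinuousLinearMap.opNorm_le_bound _ zero_le_one fun y => by
    rw [one_mul]
    exact L2.norm_le_of_coord_eq (fun _ _ h => (Nat.pair_eq_pair.1 h).2) (coord_blockProj k · y)

/-- The isometry `R_k^*` of `ℓ²`. -/
def blockIncl (k : ℕ) : SeqL2 →L[ℂ] SeqL2 := ContinuousLinearMap.adjoint (blockProj k)

lemma blockProj_basisL2 (k l i : ℕ) :
    blockProj k (basisL2 (Nat.pair l i)) = if k = l then basisL2 i else 0 := by
  ext j
  rw [coord_blockProj, basisL2, L2.coord_single]
  rcases eq_or_ne k l with rfl | h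
  · simp [basisL2, L2.coord_single, Nat.pair_eq_pair]
  · simp [h, Nat.pair_eq_pair]

/-- The index sets `{⟨k, i⟩ : i ∈ ℕ}` are disjoint for different `k`, so the isometries `R_k^*` have
mutually orthogonal ranges. -/
lemma blockProj_blockIncl (k l : ℕ) (y : SeqL2) :
    blockProj k (blockIncl l y) = if k = l then y else 0 := by
  ext i
  rw [coord_blockProj, ← inner_basisL2, blockIncl, ContinuousLinearMap.adjoint_inner_right,
    blockProj_basisL2]
  rcases eq_or_ne k l with rfl | h
  · simp [inner_basisL2]
  · simp [h, h.symm]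

variable {K : Type*} [NormedAddCommGroup K] [InnerProductSpace ℂ K]

lemma norm_tensorOp_one_le {b : SeqL2 →L[ℂ] SeqL2} (hb : ‖b‖ ≤ 1) :
    ‖tensorOp (1 : K →L[ℂ] K) b‖ ≤ 1 :=
  (norm_tensorOp_le _ _).trans (mul_le_one₀ ContinuousLinearMap.norm_id_le (norm_nonneg _) hb)

/-- On elementary tensors `(1 ⊗ b)* = 1 ⊗ b*`, and these are total. The adjoint exists without
completeness of `K`, since `TensorL2 K` is a completion. -/
lemma inner_tensorOp_one_adjoint (b : SeqL2 →L[ℂ] SeqL2) (u v : TensorL2 K) :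
    ⟪tensorOp 1 (ContinuousLinearMap.adjoint b) u, v⟫_ℂ = ⟪u, tensorOp 1 b v⟫_ℂ := by
  have h : tensorOp (1 : K →L[ℂ] K) (ContinuousLinearMap.adjoint b) =
      ContinuousLinearMap.adjoint (tensorOp 1 b) := tensorOp_ext fun x y => by
    refine ext_inner_right ℂ fun w => ?_
    refine mem_of_tmulL2_mem (LinearMap.eqLocus
      (innerSL ℂ (tensorOp 1 (ContinuousLinearMap.adjoint b) (tmulL2 x y))).toLinearMap
      (innerSL ℂ (ContinuousLinearMap.adjoint (tensorOp 1 b) (tmulL2 x y))).toLinearMap)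
      (isClosed_eq (ContinuousLinearMap.continuous _) (ContinuousLinearMap.continuous _))
      (fun x' y' => ?_) w
    change ⟪tensorOp 1 (ContinuousLinearMap.adjoint b) (tmulL2 x y), tmulL2 x' y'⟫_ℂ =
      ⟪ContinuousLinearMap.adjoint (tensorOp 1 b) (tmulL2 x y), tmulL2 x' y'⟫_ℂ
    rw [ContinuousLinearMap.adjoint_inner_left, tensorOp_tmulL2, tensorOp_tmulL2, inner_tmulL2,
      inner_tmulL2, ContinuousLinearMap.adjoint_inner_left]
    rfl
  rw [h, ContinuousLinearMap.adjoint_inner_left]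

variable (K) in
/-- The isometry `1 ⊗ R_k^*` of `K ⊗ ℓ²`. -/
def inclTensor (k : ℕ) : TensorL2 K →L[ℂ] TensorL2 K := tensorOp 1 (blockIncl k)

variable (K) in
/-- The coisometry `1 ⊗ R_k` of `K ⊗ ℓ²`. -/
def projTensor (k : ℕ) : TensorL2 K →L[ℂ] TensorL2 K := tensorOp 1 (blockProj k)

lemma inner_inclTensor_left (k : ℕ) (u v : TensorL2 K) :
    ⟪inclTensor K k u, v⟫_ℂ = ⟪u, projTensor K k v⟫_ℂ := inner_tensorOp_one_adjoint _ _ _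

lemma inner_inclTensor_right (k : ℕ) (u v : TensorL2 K) :
    ⟪u, inclTensor K k v⟫_ℂ = ⟪projTensor K k u, v⟫_ℂ := by
  rw [← inner_conj_symm, inner_inclTensor_left, inner_conj_symm]

lemma projTensor_inclTensor (k l : ℕ) (u : TensorL2 K) :
    projTensor K k (inclTensor K l u) = if k = l then u else 0 := by
  have h : projTensor K k ∘L inclTensor K l = if k = l then 1 else 0 := tensorOp_ext fun x y => by
    simp only [ContinuousLinearMap.comp_apply, projTensor, inclTensor, tensorOp_tmulL2,
      blockProj_blockIncl]
    split_ifs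
    · rfl
    · rw [map_zero]; rfl
  have := DFunLike.congr_fun h u
  rw [ContinuousLinearMap.comp_apply] at this
  rw [this]
  split_ifs <;> rfl

lemma norm_inclTensor (k : ℕ) (u : TensorL2 K) : ‖inclTensor K k u‖ = ‖u‖ := by
  rw [@norm_eq_sqrt_re_inner ℂ, @norm_eq_sqrt_re_inner ℂ _ _ _ _ u, inner_inclTensor_left,
    projTensor_inclTensor, if_pos rfl]

lemma norm_inclTensor_add_sq {k l : ℕ} (h : k ≠ l) (u v : TensorL2 K) :
    ‖inclTensor K k u + inclTensor K l v‖ ^ 2 = ‖u‖ ^ 2 + ‖v‖ ^ 2 := by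
  rw [@norm_add_sq ℂ, inner_inclTensor_left, projTensor_inclTensor, if_neg h, norm_inclTensor,
    norm_inclTensor]
  simp

/-- Bessel's inequality for two of the orthogonal ranges. -/
lemma norm_projTensor_sq_add_le {k l : ℕ} (h : k ≠ l) (v : TensorL2 K) :
    ‖projTensor K k v‖ ^ 2 + ‖projTensor K l v‖ ^ 2 ≤ ‖v‖ ^ 2 := by
  rw [← norm_inclTensor_add_sq h]
  set p := inclTensor K k (projTensor K k v) + inclTensor K l (projTensor K l v) with hp
  -- Since `p` is the orthogonal projection of `v` onto the sum of the two ranges, `‖p‖² = Re ⟪p,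
  -- v⟫`.
  have h1 : ‖p‖ ^ 2 ≤ ‖p‖ * ‖v‖ := by
    refine le_trans (le_of_eq ?_) ((RCLike.re_le_norm _).trans (norm_inner_le_norm (𝕜 := ℂ) p v))
    rw [hp, norm_inclTensor_add_sq h, inner_add_left, inner_inclTensor_left, inner_inclTensor_left,
      map_add, inner_self_eq_norm_sq, inner_self_eq_norm_sq]
  have h2 : ‖p‖ ≤ ‖v‖ := by
    rcases (norm_nonneg p).eq_or_lt with h0 | h0
    · rw [← h0]; positivity
    · exact le_of_mul_le_mul_left (by rwa [sq] at h1) h0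
  exact pow_le_pow_left₀ (norm_nonneg _) h2 2

variable {E : Submodule ℂ (K →L[ℂ] K)}

/-- The placement `a ↦ (1 ⊗ R_k^*) a (1 ⊗ R_k)` of an operator in the `k`-th diagonal block. -/
def blockMin (E : Submodule ℂ (K →L[ℂ] K)) (k : ℕ) : MinTensor E →ₗ[ℂ] MinTensor E :=
  LinearMap.codRestrict (LinearMap.range (algTensor E)).topologicalClosure
    { toFun := fun a => inclTensor K k ∘L MinTensor.val a ∘L projTensor K k
      map_add' := fun a b => by ext v; simp
      map_smul' := fun c a => by ext v; simp } fun a => by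
    have hc : Continuous fun a : MinTensor E =>
        inclTensor K k ∘L MinTensor.val a ∘L projTensor K k := by fun_prop
    refine (denseRange_toMinTensor E).induction_on
      (p := fun a => inclTensor K k ∘L MinTensor.val a ∘L projTensor K k ∈
        (LinearMap.range (algTensor E)).topologicalClosure) a
      ((Submodule.isClosed_topologicalClosure _).preimage hc) fun t => ?_
    rw [val_toMinTensor]
    induction t using AlgTensor.induction with
    | zero => rw [map_zero, ContinuousLinearMap.zero_comp, ContinuousLinearMap.comp_zero]
              exact zero_mem _
    | tmul T b =>
      -- Moving `T ⊗ b` to block `k` gives `T ⊗ R_k^* b R_k`, whose second leg is again compact.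
      refine Submodule.le_topologicalClosure _ ⟨AlgTensor.tmul T
        ⟨blockIncl k ∘L (b : SeqL2 →L[ℂ] SeqL2) ∘L blockProj k,
          (b.2.comp_clm (blockProj k)).clm_comp (blockIncl k)⟩, tensorOp_ext fun x y => ?_⟩
      simp [inclTensor, projTensor]
    | add t t' ht ht' =>
      rw [map_add, ContinuousLinearMap.add_comp, ContinuousLinearMap.comp_add]
      exact add_mem ht ht'

lemma val_blockMin (k : ℕ) (a : MinTensor E) :
    (blockMin E k a).val = inclTensor K k ∘L a.val ∘L projTensor K k := rfl

lemma val_blockMin_apply (k : ℕ) (a : MinTensor E) (v : TensorL2 K) :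
    (blockMin E k a).val v = inclTensor K k (a.val (projTensor K k v)) := rfl

lemma inner_val_blockMin (k : ℕ) (a : MinTensor E) (u v : TensorL2 K) :
    ⟪u, (blockMin E k a).val v⟫_ℂ = ⟪projTensor K k u, a.val (projTensor K k v)⟫_ℂ := by
  rw [val_blockMin_apply, inner_inclTensor_right]

lemma norm_blockMin_le (k : ℕ) (a : MinTensor E) : ‖blockMin E k a‖ ≤ ‖a‖ := by
  refine ContinuousLinearMap.opNorm_le_bound _ (norm_nonneg _) fun v => ?_
  change ‖inclTensor K k (a.val (projTensor K k v))‖ ≤ ‖a.val‖ * ‖v‖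
  rw [norm_inclTensor]
  refine (a.val.le_opNorm _).trans (mul_le_mul_of_nonneg_left ?_ (norm_nonneg _))
  exact (ContinuousLinearMap.le_of_opNorm_le (projTensor K k)
    (norm_tensorOp_one_le (norm_blockProj_le k)) v).trans_eq (one_mul _)

lemma continuous_blockMin (k : ℕ) : Continuous (blockMin E k) :=
  ((blockMin E k).mkContinuous 1 fun a => (norm_blockMin_le k a).trans_eq
    (one_mul _).symm).continuous

/-- Different blocks have orthogonal supports and ranges, so the norm of the sum is governed by the
larger block. This keeps a merged operator in the unit ball. -/
lemma norm_blockMin_add_le {k l : ℕ} (h : k ≠ l) {a b : MinTensor E} {C : ℝ} (hC : 0 ≤ C)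
    (ha : ‖a‖ ≤ C) (hb : ‖b‖ ≤ C) : ‖blockMin E k a + blockMin E l b‖ ≤ C := by
  refine ContinuousLinearMap.opNorm_le_bound _ hC fun v => le_of_sq_le_sq ?_ (by positivity)
  change ‖inclTensor K k (a.val (projTensor K k v)) + inclTensor K l (b.val (projTensor K l v))‖ ^ 2
    ≤ _
  have h1 : ‖a.val (projTensor K k v)‖ ≤ C * ‖projTensor K k v‖ := a.val.le_of_opNorm_le ha _
  have h2 : ‖b.val (projTensor K l v)‖ ≤ C * ‖projTensor K l v‖ := b.val.le_of_opNorm_le hb _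
  rw [norm_inclTensor_add_sq h]
  calc _ ≤ (C * ‖projTensor K k v‖) ^ 2 + (C * ‖projTensor K l v‖) ^ 2 := by gcongr
    _ = C ^ 2 * (‖projTensor K k v‖ ^ 2 + ‖projTensor K l v‖ ^ 2) := by ring
    _ ≤ C ^ 2 * ‖v‖ ^ 2 := by gcongr; exact norm_projTensor_sq_add_le h v
    _ = _ := by ring

/-- `Φ ⊗ id` acts on the first leg only and the passage to a block on the second only, so they
commute on elementary tensors and by continuity everywhere. -/
lemma amplify_blockMin {Φ : E →ₗ[ℂ] E} (hΦ : IsCB E.subtype Φ) (k : ℕ) (a : MinTensor E) :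
    amplify Φ (blockMin E k a) = blockMin E k (amplify Φ a) := by
  suffices h : ∀ b T, amplify Φ (blockMin E k (tmulMin E b T)) =
      blockMin E k (amplify Φ (tmulMin E b T)) from
    mem_of_tmulMin_mem (LinearMap.eqLocus ((amplify Φ).toLinearMap ∘ₗ blockMin E k)
      (blockMin E k ∘ₗ (amplify Φ).toLinearMap))
      (isClosed_eq ((amplify Φ).continuous.comp (continuous_blockMin k))
        ((continuous_blockMin k).comp (amplify Φ).continuous)) h a
  intro b T
  have hb : ∀ T, blockMin E k (tmulMin E b T) =
      tmulMin E ⟨blockIncl k ∘L (b : SeqL2 →L[ℂ] SeqL2) ∘L blockProj k,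
          (b.2.comp_clm (blockProj k)).clm_comp (blockIncl k)⟩ T := fun T => by
    refine Subtype.ext (tensorOp_ext fun x y => ?_)
    change inclTensor K k (tensorOp T b (projTensor K k (tmulL2 x y))) =
      tensorOp T (blockIncl k ∘L (b : SeqL2 →L[ℂ] SeqL2) ∘L blockProj k) (tmulL2 x y)
    simp [inclTensor, projTensor]
  rw [hb, amplify_tmulMin hΦ, amplify_tmulMin hΦ, hb]

end Blocks

/-! ### Vector functionals: convexity, density and exact representation. -/

section UnitBall

section

variable {A G H : Type*} [NonUnitalCStarAlgebra A] [Group G] [NormedAddCommGroup H]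
  [InnerProductSpace ℂ H] [CompleteSpace H] (D : CStarSystem A G H)

/-- The functional `F ↦ ⟪η, (S_F ⊗ id)(a) ξ⟫`. -/
def vectorOmega (a : MinTensor D.crossedProduct) (η ξ : TensorL2 (L2 G H)) :
    StrongDual ℂ D.CentralMultiplier :=
  D.omega a (vectorFunctional (vnAlg D) η ξ)

lemma vectorOmega_apply (a : MinTensor D.crossedProduct) (η ξ : TensorL2 (L2 G H))
    (F : D.CentralMultiplier) : vectorOmega D a η ξ F = ⟪η, (amplify F.S a).val ξ⟫_ℂ := rfl

lemma norm_vectorOmega_le (a : MinTensor D.crossedProduct) (η ξ : TensorL2 (L2 G H)) :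
    ‖vectorOmega D a η ξ‖ ≤ ‖a‖ * ‖η‖ * ‖ξ‖ := by
  refine ContinuousLinearMap.opNorm_le_bound _ (by positivity) fun F => ?_
  refine (norm_omega_apply_le a _ F).trans (mul_le_mul_of_nonneg_right ?_ (norm_nonneg _))
  rw [mul_comm, mul_assoc]
  exact mul_le_mul_of_nonneg_left (LinearMap.mkContinuous_norm_le _ (by positivity) _)
    (norm_nonneg _)

/-- The functionals `F ↦ ⟪η, (S_F ⊗ id)(a) ξ⟫` with `a`, `η`, `ξ` in the unit balls. -/
def vectorBall : Set (StrongDual ℂ D.CentralMultiplier) :=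
  {ω | ∃ a η ξ, ‖a‖ ≤ 1 ∧ ‖η‖ ≤ 1 ∧ ‖ξ‖ ≤ 1 ∧ ω = vectorOmega D a η ξ}

/-- Put the two operators in blocks `0` and `1` and use the vectors `√s η ⊕ √t η'` and `√s ξ ⊕ √t
ξ'`. Orthogonality kills the cross terms, the square roots multiply to the weights `s` and `t`, and
`s + t = 1` keeps the vectors in the unit ball. -/
lemma convex_vectorBall : Convex ℝ (vectorBall D) := by
  rintro _ ⟨a, η, ξ, ha, hη, hξ, rfl⟩ _ ⟨a', η', ξ', ha', hη', hξ', rfl⟩ s t hs ht hst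
  have hle : ∀ ζ ζ' : TensorL2 (L2 G H), ‖ζ‖ ≤ 1 → ‖ζ'‖ ≤ 1 →
      ‖inclTensor _ 0 ((√s : ℂ) • ζ) + inclTensor _ 1 ((√t : ℂ) • ζ')‖ ≤ 1 := by
    intro ζ ζ' hζ hζ'
    refine le_of_sq_le_sq ?_ zero_le_one
    rw [norm_inclTensor_add_sq zero_ne_one, norm_smul, norm_smul, mul_pow, mul_pow,
      Complex.norm_real, Complex.norm_real, Real.norm_eq_abs, Real.norm_eq_abs, sq_abs, sq_abs,
      Real.sq_sqrt hs, Real.sq_sqrt ht]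
    have h1 : ‖ζ‖ ^ 2 ≤ 1 := pow_le_one₀ (norm_nonneg _) hζ
    have h2 : ‖ζ'‖ ^ 2 ≤ 1 := pow_le_one₀ (norm_nonneg _) hζ'
    nlinarith
  refine ⟨blockMin _ 0 a + blockMin _ 1 a', _, _,
    norm_blockMin_add_le zero_ne_one zero_le_one ha ha', hle η η' hη hη', hle ξ ξ' hξ hξ', ?_⟩
  have hsqrt : ∀ {r : ℝ}, 0 ≤ r → (√r : ℂ) * (√r : ℂ) = r := fun hr => by
    rw [← Complex.ofReal_mul, Real.mul_self_sqrt hr]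
  ext F
  have hF : amplify F.S (blockMin _ 0 a + blockMin _ 1 a') =
      blockMin _ 0 (amplify F.S a) + blockMin _ 1 (amplify F.S a') := by
    rw [map_add, amplify_blockMin F.isCB_S, amplify_blockMin F.isCB_S]
  rw [add_apply, vectorOmega_apply, hF, map_add MinTensor.val, add_apply, inner_add_right,
    inner_val_blockMin, inner_val_blockMin]
  simp [projTensor_inclTensor, vectorOmega_apply]
  linear_combination -⟪η, (amplify F.S a).val ξ⟫_ℂ * hsqrt hs -
    ⟪η', (amplify F.S a').val ξ'⟫_ℂ * hsqrt ht

lemma zero_mem_vectorBall : 0 ∈ vectorBall D :=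
  ⟨0, 0, 0, by simp, by simp, by simp, by ext F; simp [vectorOmega_apply]⟩

lemma smul_mem_vectorBall {c : ℂ} (hc : ‖c‖ ≤ 1) {ω : StrongDual ℂ D.CentralMultiplier}
    (hω : ω ∈ vectorBall D) : c • ω ∈ vectorBall D := by
  obtain ⟨a, η, ξ, ha, hη, hξ, rfl⟩ := hω
  refine ⟨c • a, η, ξ, ?_, hη, hξ, ?_⟩
  · rw [norm_smul]
    exact mul_le_one₀ hc (norm_nonneg _) ha
  · ext F
    simp [vectorOmega_apply]

/-- The norm of a multiplier is determined by the vector functionals. -/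
lemma norm_le_of_forall_vectorBall {F : D.CentralMultiplier} {M : ℝ} (hM : 0 ≤ M)
    (h : ∀ ω ∈ vectorBall D, ‖ω F‖ ≤ M) : ‖F‖ ≤ M := by
  refine (cbBound_of_norm_inner_amplify_le F.isCB_S hM fun a η ξ => ?_).cbNorm_le
  rw [← vectorOmega_apply]
  have hnorm : ∀ {X : Type _} [NormedAddCommGroup X] [NormedSpace ℂ X] (x : X),
      ∃ y : X, ‖y‖ ≤ 1 ∧ x = (‖x‖ : ℂ) • y := fun x => by
    -- With `0⁻¹ = 0` the normalised vector is still in the unit ball when `x = 0`.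
    refine ⟨(‖x‖ : ℂ)⁻¹ • x, ?_, ?_⟩
    · rw [norm_smul, norm_inv, Complex.norm_real, norm_norm]
      exact inv_mul_le_one
    · rcases eq_or_ne x 0 with rfl | hx
      · simp
      · rw [smul_smul, mul_inv_cancel₀ (by exact_mod_cast norm_ne_zero_iff.2 hx), one_smul]
  obtain ⟨a₁, ha₁, ha⟩ := hnorm a
  obtain ⟨η₁, hη₁, hη⟩ := hnorm η
  obtain ⟨ξ₁, hξ₁, hξ⟩ := hnorm ξ
  have heq : vectorOmega D a η ξ F =
      (‖a‖ * ‖η‖ * ‖ξ‖ : ℂ) * vectorOmega D a₁ η₁ ξ₁ F := by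
    rw [vectorOmega_apply, vectorOmega_apply]
    conv_lhs => rw [ha, hη, hξ]
    simp only [map_smul, smul_apply, inner_smul_left, inner_smul_right, Complex.conj_ofReal]
    ring
  rw [heq, norm_mul, norm_mul, norm_mul, Complex.norm_real, Complex.norm_real, Complex.norm_real,
    norm_norm, norm_norm, norm_norm]
  refine (mul_le_mul_of_nonneg_left (h _ ⟨a₁, η₁, ξ₁, ha₁, hη₁, hξ₁, rfl⟩)
    (by positivity)).trans_eq (by ring)

end

variable {Z G H : Type*} [TopologicalSpace Z] [DiscreteTopology Z] [Group G]
  [NormedAddCommGroup H] [InnerProductSpace ℂ H] [CompleteSpace H]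
  (D : CStarSystem C₀(Z, ℂ) G H)

/-- A functional on the dual of the central multipliers is, on `Q_cent`, the evaluation at a
central multiplier. -/
lemma exists_multiplier_eq_on_Qcent (Λ : StrongDual ℂ (StrongDual ℂ D.CentralMultiplier)) :
    ∃ F : D.CentralMultiplier,
      ∀ q ∈ (LinearMap.range (pairing D)).topologicalClosure, Λ q = q F := by
  obtain ⟨F, hF⟩ := exists_multiplier_of_bidual D Λ
  refine ⟨F, fun q hq => ?_⟩
  have hle : (LinearMap.range (pairing D)).topologicalClosure ≤ LinearMap.eqLocus Λ.toLinearMap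
      (ContinuousLinearMap.apply ℂ ℂ F).toLinearMap := by
    refine Submodule.topologicalClosure_minimal _ ?_
      (isClosed_eq Λ.continuous (ContinuousLinearMap.apply ℂ ℂ F).continuous)
    rintro _ ⟨ψ, rfl⟩
    change Λ (pairing D ψ) = pairing D ψ F
    simp only [pairing, Finsupp.linearCombination_apply, Finsupp.sum, map_sum, map_smul, sum_apply,
      smul_apply, hF]
  exact hle hq

lemma vectorOmega_mem (a : MinTensor D.crossedProduct) (η ξ : TensorL2 (L2 G H)) :
    vectorOmega D a η ξ ∈ (LinearMap.range (pairing D)).topologicalClosure :=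
  omega_mem D a _

/-- The unit ball of `Q_cent` is the closure of the set of vector functionals. -/
lemma mem_closure_vectorBall {q : StrongDual ℂ D.CentralMultiplier}
    (hq : q ∈ (LinearMap.range (pairing D)).topologicalClosure) (h1 : ‖q‖ ≤ 1) :
    q ∈ closure (vectorBall D) := by
  by_contra hcl
  -- The separating functional lives on the whole dual of the multipliers. On `Q_cent`, which
  -- contains both `q` and `vectorBall`, it is evaluation at some `F`, so the separation contradicts
  -- `|q(F)| ≤ ‖F‖`.
  obtain ⟨Λ, u, hu, hqu⟩ := RCLike.geometric_hahn_banach_closed_point (𝕜 := ℂ)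
    (convex_vectorBall D).closure isClosed_closure hcl
  obtain ⟨F, hF⟩ := exists_multiplier_eq_on_Qcent D Λ
  have hu0 : 0 < u := by simpa using hu 0 (subset_closure (zero_mem_vectorBall D))
  have hnorm : ‖F‖ ≤ u := norm_le_of_forall_vectorBall D hu0.le fun ω hω => by
    rcases eq_or_ne (ω F) 0 with h0 | h0
    · rw [h0, norm_zero]; exact hu0.le
    -- Rotating `ω` by this phase makes `ω(F)` equal to its modulus, so the separation bound on real
    -- parts bounds `|ω(F)|`.
    have hc : ‖(starRingEnd ℂ (ω F)) / (‖ω F‖ : ℂ)‖ ≤ 1 := by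
      rw [norm_div, RCLike.norm_conj, Complex.norm_real, norm_norm, div_self (norm_ne_zero_iff.2 h0)]
    have h := hu _ (subset_closure (smul_mem_vectorBall D hc hω))
    have hωF : Λ ω = ω F := by
      obtain ⟨a, η, ξ, -, -, -, rfl⟩ := hω
      exact hF _ (vectorOmega_mem D a η ξ)
    rw [map_smul, hωF, smul_eq_mul, div_mul_eq_mul_div, mul_comm, Complex.mul_conj,
      Complex.normSq_eq_norm_sq, ← Complex.ofReal_div, sq, mul_self_div_self] at h
    exact h.le
  rw [hF q hq] at hqu
  have : ‖q F‖ ≤ u := (q.le_opNorm F).trans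
    ((mul_le_mul h1 hnorm (norm_nonneg _) zero_le_one).trans_eq (one_mul u))
  exact absurd (hqu.trans_le ((RCLike.re_le_norm _).trans this)) (lt_irrefl u)

/-- Approximation of elements of `Q_cent` by vector functionals. -/
lemma exists_norm_sub_vectorOmega_le (q : StrongDual ℂ D.CentralMultiplier)
    (hq : q ∈ (LinearMap.range (pairing D)).topologicalClosure) :
    ∃ a η ξ, ‖a‖ ≤ 1 ∧ ‖η‖ ≤ 1 ∧ ‖ξ‖ ≤ 1 ∧
      ‖q - (‖q‖ : ℂ) • vectorOmega D a η ξ‖ ≤ 8⁻¹ * ‖q‖ := by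
  rcases eq_or_ne q 0 with rfl | h0
  · exact ⟨0, 0, 0, by simp, by simp, by simp, by
      rw [norm_zero, mul_zero, norm_le_zero_iff]
      ext F
      simp [vectorOmega_apply]⟩
  have hpos : 0 < ‖q‖ := norm_pos_iff.2 h0
  have hmem := mem_closure_vectorBall D (Submodule.smul_mem _ ((‖q‖ : ℂ)⁻¹) hq) (by
    rw [norm_smul, norm_inv, Complex.norm_real, norm_norm]
    exact inv_mul_le_one)
  obtain ⟨_, ⟨a, η, ξ, ha, hη, hξ, rfl⟩, hlt⟩ :=
    Metric.mem_closure_iff.1 hmem 8⁻¹ (by norm_num)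
  refine ⟨a, η, ξ, ha, hη, hξ, ?_⟩
  have heq : q - (‖q‖ : ℂ) • vectorOmega D a η ξ =
      (‖q‖ : ℂ) • ((‖q‖ : ℂ)⁻¹ • q - vectorOmega D a η ξ) := by
    rw [smul_sub, smul_smul, mul_inv_cancel₀ (by exact_mod_cast hpos.ne'), one_smul]
  rw [heq, norm_smul, Complex.norm_real, norm_norm, mul_comm]
  rw [dist_eq_norm] at hlt
  exact mul_le_mul_of_nonneg_right hlt.le hpos.le

/-- A series of vector functionals is a single one. -/
lemma exists_vectorOmega_hasSum {A G H : Type*} [NonUnitalCStarAlgebra A] [Group G]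
    [NormedAddCommGroup H] [InnerProductSpace ℂ H] [CompleteSpace H] (D : CStarSystem A G H)
    {c : ℕ → ℝ} {C : ℝ} (hc : ∀ k, ‖c k‖ ≤ 8⁻¹ ^ k * C)
    {a : ℕ → MinTensor D.crossedProduct} {η ξ : ℕ → TensorL2 (L2 G H)}
    (ha : ∀ k, ‖a k‖ ≤ 1) (hη : ∀ k, ‖η k‖ ≤ 1) (hξ : ∀ k, ‖ξ k‖ ≤ 1) :
    ∃ a' η' ξ', ∀ F : D.CentralMultiplier,
      HasSum (fun k => (c k : ℂ) * vectorOmega D (a k) (η k) (ξ k) F)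
        (vectorOmega D a' η' ξ' F) := by
  -- The weight is split as `c_k = (4^k c_k) · 2^{-k} · 2^{-k}` between the operator and the two
  -- vectors. From `|c_k| ≤ 8^{-k} C` the operator terms have norm at most `2^{-k} C`, so all three
  -- series converge absolutely.
  have hgeom : Summable fun k : ℕ => (2⁻¹ : ℝ) ^ k :=
    summable_geometric_of_lt_one (by norm_num) (by norm_num)
  have hvec : ∀ ζ : ℕ → TensorL2 (L2 G H), (∀ k, ‖ζ k‖ ≤ 1) →
      ∃ ζ', ∀ k, projTensor _ k ζ' = (2⁻¹ : ℂ) ^ k • ζ k := fun ζ hζ => by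
    have hs : Summable fun k => inclTensor (L2 G H) k ((2⁻¹ : ℂ) ^ k • ζ k) :=
      Summable.of_norm_bounded hgeom fun k => by
        rw [norm_inclTensor, norm_smul, norm_pow, norm_inv, Complex.norm_ofNat]
        exact mul_le_of_le_one_right (by positivity) (hζ k)
    refine ⟨_, fun k => (hs.hasSum.mapL (projTensor _ k)).unique ?_⟩
    simp only [projTensor_inclTensor]
    convert hasSum_ite_eq k ((2⁻¹ : ℂ) ^ k • ζ k) using 2 with l
    rcases eq_or_ne l k with rfl | h
    · simp
    · simp [h, h.symm]
  obtain ⟨η', hη'⟩ := hvec η hη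
  obtain ⟨ξ', hξ'⟩ := hvec ξ hξ
  have hs : Summable fun k => ((4 : ℂ) ^ k * c k) • blockMin D.crossedProduct k (a k) :=
    Summable.of_norm_bounded (hgeom.mul_right C) fun k => by
      rw [norm_smul, norm_mul, norm_pow, Complex.norm_ofNat, Complex.norm_real]
      refine (mul_le_of_le_one_right (by positivity) ((norm_blockMin_le k _).trans (ha k))).trans ?_
      refine (mul_le_mul_of_nonneg_left (hc k) (by positivity)).trans_eq ?_
      rw [← mul_assoc, ← mul_pow]
      norm_num
  refine ⟨∑' k, ((4 : ℂ) ^ k * c k) • blockMin D.crossedProduct k (a k), η', ξ', fun F => ?_⟩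
  have h1 := (hs.hasSum.mapL (omegaL D (vectorFunctional (vnAlg D) η' ξ'))).mapL
    (ContinuousLinearMap.apply ℂ ℂ F)
  refine h1.congr fun T => Finset.sum_congr rfl fun k _ => ?_
  beta_reduce
  rw [map_smul, map_smul, smul_eq_mul]
  change _ * ⟪η', (amplify F.S (blockMin _ k (a k))).val ξ'⟫_ℂ = _
  rw [amplify_blockMin F.isCB_S, inner_val_blockMin, hη', hξ', map_smul, inner_smul_left,
    inner_smul_right, vectorOmega_apply, map_pow, map_inv₀, Complex.conj_ofNat]
  have h4 : (4 : ℂ) ^ k * (2⁻¹ ^ k * 2⁻¹ ^ k) = 1 := by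
    rw [← mul_pow, ← mul_pow]
    norm_num
  linear_combination ((c k : ℂ) * ⟪η k, (amplify F.S (a k)).val (ξ k)⟫_ℂ) * h4

/-- Every element of `Q_cent` is a vector functional. -/
lemma exists_eq_vectorOmega (q : StrongDual ℂ D.CentralMultiplier)
    (hq : q ∈ (LinearMap.range (pairing D)).topologicalClosure) :
    ∃ a η ξ, q = vectorOmega D a η ξ := by
  -- The chosen approximants are total functions, but their estimates hold on `Q_cent` only; `hmem`
  -- keeps the remainders there.
  choose! a η ξ ha hη hξ happ using exists_norm_sub_vectorOmega_le D
  -- Each step subtracts an approximating vector functional and shrinks the remainder by a factor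
  -- `8`, the decay required by `exists_vectorOmega_hasSum`.
  let step : StrongDual ℂ D.CentralMultiplier → StrongDual ℂ D.CentralMultiplier := fun p =>
    p - (‖p‖ : ℂ) • vectorOmega D (a p) (η p) (ξ p)
  let r : ℕ → StrongDual ℂ D.CentralMultiplier := fun k => step^[k] q
  have hr : ∀ k, r (k + 1) = r k - (‖r k‖ : ℂ) • vectorOmega D (a (r k)) (η (r k)) (ξ (r k)) :=
    fun k => Function.iterate_succ_apply' step k q
  have hmem : ∀ k, r k ∈ (LinearMap.range (pairing D)).topologicalClosure := fun k => by
    induction k with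
    | zero => exact hq
    | succ k ih =>
      rw [hr]
      exact sub_mem ih (Submodule.smul_mem _ _ (vectorOmega_mem D _ _ _))
  have hnorm : ∀ k, ‖r k‖ ≤ 8⁻¹ ^ k * ‖q‖ := fun k => by
    induction k with
    | zero => simp [r]
    | succ k ih =>
      rw [hr, pow_succ', mul_assoc]
      exact (happ _ (hmem k)).trans (mul_le_mul_of_nonneg_left ih (by norm_num))
  obtain ⟨a', η', ξ', hsum⟩ := exists_vectorOmega_hasSum D (c := fun k => ‖r k‖) (C := ‖q‖)
    (fun k => by rw [norm_norm]; exact hnorm k) (fun k => ha _ (hmem k)) (fun k => hη _ (hmem k))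
    (fun k => hξ _ (hmem k))
  refine ⟨a', η', ξ', ?_⟩
  ext F
  -- The partial sums telescope, leaving the remainder `r n`, which tends to `0`.
  have hpart : ∀ n, ∑ k ∈ Finset.range n,
      (‖r k‖ : ℂ) * vectorOmega D (a (r k)) (η (r k)) (ξ (r k)) F = q F - r n F := fun n => by
    induction n with
    | zero => simp [r]
    | succ n ih =>
      rw [Finset.sum_range_succ, ih, hr, sub_apply, smul_apply, smul_eq_mul]
      ring
  have hlim : Filter.Tendsto r Filter.atTop (𝓝 0) := by
    refine squeeze_zero_norm hnorm ?_
    simpa using (tendsto_pow_atTop_nhds_zero_of_lt_one (r := (8⁻¹ : ℝ)) (by norm_num)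
      (by norm_num)).mul_const ‖q‖
  refine tendsto_nhds_unique ?_ (hsum F).tendsto_sum_nat
  simp only [hpart]
  have h := ((ContinuousLinearMap.apply ℂ ℂ F).continuous.tendsto 0).comp hlim
  simpa using h.const_sub (q F)

end UnitBall

end HerzSchur

end

/-! ### The duality and the description of `Q_cent`. -/

open HerzSchur
theorem proposition4p7 {Z G H : Type*} [TopologicalSpace Z] [DiscreteTopology Z] [Group G]
    [NormedAddCommGroup H] [InnerProductSpace ℂ H] [CompleteSpace H]
    (D : CStarSystem C₀(Z, ℂ) G H) :
    (∃ J : D.CentralMultiplier ≃ₗᵢ[ℂ] StrongDual ℂ (Qcent D),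
      ∀ (F : D.CentralMultiplier) (q : Qcent D), J F q = Qcent.toDual D q F) ∧
    Set.range (Qcent.toDual D) =
      {ω | ∃ (a : MinTensor D.crossedProduct)
        (f : vnTensor (bicommutant (D.crossedProduct : Set (L2 G H →L[ℂ] L2 G H))) →L[ℂ] ℂ),
        IsNormal f ∧ ω = D.omega a f} := by
  have hrange : ∀ ω, ω ∈ Set.range (Qcent.toDual D) ↔
      ω ∈ (LinearMap.range (pairing D)).topologicalClosure :=
    fun ω => ⟨by rintro ⟨q, rfl⟩; exact Subtype.prop _, fun h => ⟨⟨ω, h⟩, rfl⟩⟩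
  constructor
  · let ev : D.CentralMultiplier →ₗ[ℂ] StrongDual ℂ (Qcent D) :=
      { toFun := fun F => ContinuousLinearMap.apply ℂ ℂ F ∘L Qcent.toDual D
        map_add' := fun F F' => by
          ext q; exact map_add (Qcent.toDual D q) F F'
        map_smul' := fun c F => by
          ext q; exact map_smul (Qcent.toDual D q) c F }
    have hev : ∀ F q, ev F q = Qcent.toDual D q F := fun _ _ => rfl
    have hisom : ∀ F, ‖ev F‖ = ‖F‖ := fun F => by
      apply le_antisymm
      · refine ContinuousLinearMap.opNorm_le_bound _ (norm_nonneg _) fun q => ?_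
        rw [hev, mul_comm]
        exact (Qcent.toDual D q).le_opNorm F
      -- The functionals that determine `‖F‖` are elements of the unit ball of `Q_cent`, so
      -- restricting to `Q_cent` loses no norm.
      · refine norm_le_of_forall_vectorBall D (norm_nonneg (ev F)) ?_
        rintro _ ⟨a, η, ξ, ha, hη, hξ, rfl⟩
        let q : Qcent D := ⟨vectorOmega D a η ξ, vectorOmega_mem D a η ξ⟩
        have hq : ‖q‖ ≤ 1 := (norm_vectorOmega_le D a η ξ).trans
          (mul_le_one₀ (mul_le_one₀ ha (norm_nonneg _) hη) (norm_nonneg _) hξ)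
        exact ((ev F).le_opNorm q).trans (mul_le_of_le_one_right (norm_nonneg _) hq)
    refine ⟨LinearIsometryEquiv.ofSurjective ⟨ev, hisom⟩ fun Λ => ?_, fun F q => rfl⟩
    -- Hahn–Banach extends `Λ` from `Q_cent` to the whole dual of the multipliers, where it can be
    -- applied to all matrix coefficients of the `S_F`.
    obtain ⟨Λ', hΛ', -⟩ := exists_extension_norm_eq
      (LinearMap.range (pairing D)).topologicalClosure Λ
    obtain ⟨F, hF⟩ := exists_multiplier_eq_on_Qcent D Λ'
    refine ⟨F, ?_⟩
    ext q
    exact (hF _ q.2).symm.trans (hΛ' q)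
  · ext ω
    rw [hrange]
    constructor
    · intro h
      obtain ⟨a, η, ξ, rfl⟩ := exists_eq_vectorOmega D ω h
      exact ⟨a, _, isNormal_vectorFunctional _ η ξ, rfl⟩
    · rintro ⟨a, f, -, rfl⟩
      exact omega_mem D a f
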